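/- Let $\Omega\subset\mathbb R^N$ ($N\ge 1$) be open and bounded, $\sigma(x)=\operatorname{dist}(x,\partial\Omega)$, $B_1=\{|x|<1\}$, and let $f\in BV(\Omega)$, i.e. $f\in L^1(\Omega)$ and $|Df|(\Omega):=\sup\{\int_\Omega f\,\mathrm{div}\,\phi\,dx:\ \phi\in C_c^\infty(\Omega;\mathbb R^N),\ \|\phi\|_\infty\le 1\}<\infty$. (i) Suppose that $\Omega$ has Lipschitz boundary. Let $\rho\in C_c^\infty(\mathbb R^N)$ be radially symmetric with $0\le\rho\le1$, $\rho(x)=0\iff|x|\ge1$, and $\rho(x)\ge\rho(y)$ whenever $|x|<\tfrac12=|y|$. Let $\eta\in C^\infty(\Omega)$ satisfy $\eta<\sigma$ and $\kappa\sigma^2\le\eta\le\sigma^2$ in $\Omega$ for some $\kappa>0$, and $\sup_\Omega|\nabla\eta|<\infty$. For $n\ge1$ put $$T_nf(x)=\Big(\int_{B_1}\rho\Big)^{-1}\int_{B_1}\rho(z)\,f\Big(x-\frac{\eta(x)}{n}z\Big)dz,\qquad x\in\Omega .$$ Then $T_nf\to f$ weakly* in $BV(\Omega)$ as $n\to\infty$: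 $T_nf\in BV(\Omega)$ for all $n\ge 1$, $T_nf\to f$ in $L^1(\Omega)$, and $\int_\Omega\phi\,dD(T_nf)\to\int_\Omega\phi\,dDf$ for every $\phi\in C_0(\Omega)$, where $Du$ denotes the finite $\mathbb R^N$-valued Radon measure on $\Omega$ that is the distributional derivative of $u\in BV(\Omega)$. (ii) Let $\Omega$ be any bounded open set, without assumption on its boundary, and let $n_0\ge1$ be an integer with $\sigma<n_0$ in $\Omega$. For $n\ge n_0$ let $\rho_n\in C_c^\infty(\mathbb R^N)$ with $0\le\rho_n\le1$, $\rho_n(x)=0$ for $|x|\ge1$, and $\rho_n(x)=1$ for $|x|\le1-\frac1n$; let $\eta_n\in C^\infty(\Omega)$ with $(1-\frac1n\sigma)^2\sigma^2\le\eta_n\le\sigma^2$ in $\Omega$, and suppose $\sup_{n\ge n_0}\sup_\Omega|\nabla\eta_n|<\infty$. Put $$\tilde T_nf(x)=\Big(\int_\Omega\rho_n\Big(\frac{x-y}{\eta_n(x)/n}\Big)dy\Big)^{-1}\int_\Omega\rho_n\Big(\frac{x-y}{\eta_n(x)/n}\Big)f(y)\,dy,\qquad x\in\Omega .$$ Then $\tilde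 T_nf\to f$ strictly in $BV(\Omega)$ as $n\to\infty$: $\tilde T_nf\in BV(\Omega)$ for all $n\ge n_0$, $\tilde T_nf\to f$ in $L^1(\Omega)$, and $|D\tilde T_nf|(\Omega)\to|Df|(\Omega)$. -/

import Mathlib

open MeasureTheory Filter Topology
open scoped ContDiff NNReal ZeroAtInfty

namespace BVMollifier

noncomputable section

/-- `ℝᴺ` with its Euclidean norm. -/
abbrev Eu (N : ℕ) : Type := EuclideanSpace ℝ (Fin N)

/-- The distance `σ(x) = dist(x, ∂Ω)` to the boundary. -/
def bdryDist {N : ℕ} (Ω : Set (Eu N)) (x : Eu N) : ℝ := Metric.infDist x (frontier Ω)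

/-- `Ω` has Lipschitz boundary: near each boundary point, in suitable orthonormal coordinates
(`e` is the vertical direction and `x - ⟪e, x⟫ e` the horizontal part of `x`), `Ω` is the part of
space strictly above the graph of a Lipschitz function. -/
def HasLipschitzBoundary {N : ℕ} (Ω : Set (Eu N)) : Prop :=
  ∀ p ∈ frontier Ω, ∃ r : ℝ, 0 < r ∧ ∃ e : Eu N, ‖e‖ = 1 ∧
    ∃ (K : ℝ≥0) (g : Eu N → ℝ), LipschitzWith K g ∧
      ∀ x ∈ Metric.ball p r, x ∈ Ω ↔ g (x - (inner ℝ e x) • e) < inner ℝ e x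

/-- `φ ∈ C_c^∞(Ω; F)`, extended by zero to the whole space. -/
structure IsTestFunction {N : ℕ} {F : Type*} [NormedAddCommGroup F] [NormedSpace ℝ F]
    (Ω : Set (Eu N)) (φ : Eu N → F) : Prop where
  smooth : ContDiff ℝ ∞ φ
  compact_supp : HasCompactSupport φ
  supp_subset : tsupport φ ⊆ Ω

/-- The partial derivative `∂φ/∂xᵢ`. -/
def partialDeriv {N : ℕ} (i : Fin N) (φ : Eu N → ℝ) (x : Eu N) : ℝ :=
  fderiv ℝ φ x (EuclideanSpace.single i 1)

/-- The divergence of a vector field. -/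
def divergence {N : ℕ} (φ : Eu N → Eu N) (x : Eu N) : ℝ :=
  ∑ i : Fin N, partialDeriv i (fun y => φ y i) x

/-- The variation
`V(u, Ω) = sup {∫_Ω u div φ dx : φ ∈ C_c^∞(Ω; ℝᴺ), ‖φ‖_∞ ≤ 1}`, that is `|Du|(Ω)`. The
supremum is nonnegative because of `φ = 0`, so that nothing is lost with `ENNReal.ofReal`. -/
def totalVariation {N : ℕ} (Ω : Set (Eu N)) (u : Eu N → ℝ) : ENNReal :=
  ⨆ (φ : Eu N → Eu N) (_ : IsTestFunction Ω φ) (_ : ∀ x, ‖φ x‖ ≤ 1),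
    ENNReal.ofReal (∫ x in Ω, u x * divergence φ x)

/-- `u ∈ BV(Ω)`: `u ∈ L¹(Ω)` and `V(u, Ω) < ⊤`. Only the values of `u` on `Ω` matter. -/
def IsBV {N : ℕ} (Ω : Set (Eu N)) (u : Eu N → ℝ) : Prop :=
  IntegrableOn u Ω ∧ totalVariation Ω u < ⊤

/-- The finite `ℝᴺ`-valued Radon measure `μ = (μ₁, …, μ_N)` on `Ω` is the distributional
derivative `Du`. A measure on `Ω` is a Borel measure on `ℝᴺ` that lives on `Ω`. -/
structure IsDerivMeasure {N : ℕ} (Ω : Set (Eu N)) (u : Eu N → ℝ)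
    (μ : Fin N → SignedMeasure (Eu N)) : Prop where
  concentrated : ∀ i, ∀ A : Set (Eu N), MeasurableSet A → A ⊆ Ωᶜ → μ i A = 0
  integral_by_parts : ∀ i, ∀ φ : Eu N → ℝ, IsTestFunction Ω φ →
    ∫ x in Ω, u x * partialDeriv i φ x = -∫ᵛ x, φ x ∂•μ i

/-- Convergence `uₖ → u` in `L¹(Ω)`. -/
def TendstoL1 {N : ℕ} (Ω : Set (Eu N)) (u : ℕ → Eu N → ℝ) (v : Eu N → ℝ) : Prop :=
  Tendsto (fun k => eLpNorm (fun x => u k x - v x) 1 (volume.restrict Ω)) atTop (𝓝 0)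

/-- Weak* convergence in `BV(Ω)`: all functions are in `BV(Ω)`, `uₖ → v` in `L¹(Ω)`, and
`Duₖ → Dv` weakly* as measures on `Ω`, i.e. tested with every function of `C₀(Ω)`. Here `C₀(Ω)`
consists of the continuous functions on `ℝᴺ` that vanish outside `Ω` and at infinity. -/
def TendstoWeakStarBV {N : ℕ} (Ω : Set (Eu N)) (u : ℕ → Eu N → ℝ) (v : Eu N → ℝ) : Prop :=
  (∀ k, IsBV Ω (u k)) ∧ IsBV Ω v ∧ TendstoL1 Ω u v ∧
    ∃ (μ : ℕ → Fin N → SignedMeasure (Eu N)) (ν : Fin N → SignedMeasure (Eu N)),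
      (∀ k, IsDerivMeasure Ω (u k) (μ k)) ∧ IsDerivMeasure Ω v ν ∧
        ∀ (i : Fin N) (φ : C₀(Eu N, ℝ)), (∀ x ∉ Ω, φ x = 0) →
          Tendsto (fun k => ∫ᵛ x, φ x ∂•μ k i) atTop (𝓝 (∫ᵛ x, φ x ∂•ν i))

/-- Strict convergence in `BV(Ω)`: all functions are in `BV(Ω)`, `uₖ → v` in `L¹(Ω)`, and
`|Duₖ|(Ω) → |Dv|(Ω)`. -/
def TendstoStrictBV {N : ℕ} (Ω : Set (Eu N)) (u : ℕ → Eu N → ℝ) (v : Eu N → ℝ) : Prop :=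
  (∀ k, IsBV Ω (u k)) ∧ IsBV Ω v ∧ TendstoL1 Ω u v ∧
    Tendsto (fun k => totalVariation Ω (u k)) atTop (𝓝 (totalVariation Ω v))

/-- The standard kernels `ρ`: `ρ ∈ C_c^∞`, `0 ≤ ρ ≤ 1`, `ρ(x) = 0 ↔ |x| ≥ 1` (so that the support
is the closed unit ball), radially symmetric, `ρ(x) ≥ ρ(1/2)` for `|x| < 1/2`. -/
structure IsKernel {N : ℕ} (ρ : Eu N → ℝ) : Prop where
  smooth : ContDiff ℝ ∞ ρ
  nonneg : ∀ x, 0 ≤ ρ x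
  le_one : ∀ x, ρ x ≤ 1
  eq_zero_iff : ∀ x, ρ x = 0 ↔ 1 ≤ ‖x‖
  radial : ∀ x y, ‖x‖ = ‖y‖ → ρ x = ρ y
  half_le : ∀ x y, ‖x‖ < 1 / 2 → ‖y‖ = 1 / 2 → ρ y ≤ ρ x

/-- The step functions `η` of the operators `Tₙ` on `L¹`, `W^{1,1}` and `BV`: smooth with bounded
gradient in `Ω`, `η < σ`, and `κ σ² ≤ η ≤ σ²` for some `κ > 0`. -/
structure IsStep {N : ℕ} (Ω : Set (Eu N)) (η : Eu N → ℝ) : Prop where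
  smooth : ContDiffOn ℝ ∞ η Ω
  grad_bounded : ∃ L : ℝ, ∀ x ∈ Ω, ‖fderiv ℝ η x‖ ≤ L
  lt_dist : ∀ x ∈ Ω, η x < bdryDist Ω x
  lower : ∃ κ : ℝ, 0 < κ ∧ ∀ x ∈ Ω, κ * bdryDist Ω x ^ 2 ≤ η x
  upper : ∀ x ∈ Ω, η x ≤ bdryDist Ω x ^ 2

/-- The operators
`Tₙ f(x) = M_ρ ∫_{B₁(0)} ρ(z) f(x - (η(x)/n) z) dz` with `M_ρ = (∫_{B₁(0)} ρ)⁻¹`. -/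
def moll {N : ℕ} (ρ η : Eu N → ℝ) (n : ℕ) (f : Eu N → ℝ) (x : Eu N) : ℝ :=
  (∫ z in Metric.ball (0 : Eu N) 1, ρ z)⁻¹ *
    ∫ z in Metric.ball (0 : Eu N) 1, ρ z * f (x - (η x / n) • z)

/-- The `n`-th modified kernel `ρₙ`: smooth, `0 ≤ ρₙ ≤ 1`, zero for `|x| ≥ 1`, and one for
`|x| ≤ 1 - 1/n`. -/
structure IsModKernel {N : ℕ} (n : ℕ) (ρ : Eu N → ℝ) : Prop where
  smooth : ContDiff ℝ ∞ ρ
  nonneg : ∀ x, 0 ≤ ρ x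
  le_one : ∀ x, ρ x ≤ 1
  eq_zero : ∀ x, 1 ≤ ‖x‖ → ρ x = 0
  eq_one : ∀ x, ‖x‖ ≤ 1 - 1 / (n : ℝ) → ρ x = 1

/-- The `n`-th modified step function `ηₙ`: smooth in `Ω`, `(1 - σ/n)² σ² ≤ ηₙ ≤ σ²`, and
`|∇ηₙ| ≤ L` in `Ω`. -/
structure IsModStep {N : ℕ} (Ω : Set (Eu N)) (L : ℝ) (n : ℕ) (η : Eu N → ℝ) : Prop where
  smooth : ContDiffOn ℝ ∞ η Ω
  grad_bounded : ∀ x ∈ Ω, ‖fderiv ℝ η x‖ ≤ L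
  lower : ∀ x ∈ Ω, (1 - bdryDist Ω x / n) ^ 2 * bdryDist Ω x ^ 2 ≤ η x
  upper : ∀ x ∈ Ω, η x ≤ bdryDist Ω x ^ 2

/-- The modified operators `T̃ₙ f(x) = C̃ₙ(x) ∫_Ω ρₙ((x - y) / (ηₙ(x)/n)) f(y) dy` with
`C̃ₙ(x) = (∫_Ω ρₙ((x - y) / (ηₙ(x)/n)) dy)⁻¹`. -/
def modMoll {N : ℕ} (Ω : Set (Eu N)) (ρ η : ℕ → Eu N → ℝ) (n : ℕ) (f : Eu N → ℝ)
    (x : Eu N) : ℝ :=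
  (∫ y in Ω, ρ n ((η n x / n)⁻¹ • (x - y)))⁻¹ *
    ∫ y in Ω, ρ n ((η n x / n)⁻¹ • (x - y)) * f y

end

end BVMollifier

/-! Both families are averages $Tf(x)=\int_\Omega K(x,y)f(y)\,dy$ with
$K(x,y)=(\int\rho)^{-1}s(x)^{-N}\rho(r)$, $r=(x-y)/s(x)$, and radius $s=\eta/n$. The radius depends
on $x$, so $T$ does not commute with derivatives. By duality, $\int Tf\,\mathrm{div}\,\phi=\int
f\,\mathrm{div}\,\Psi$ with $\Psi(y)=\int K(x,y)\,(\phi(x)-(\nabla s(x)\cdot\phi(x))\,r)\,dx$, again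
a test field (`divergence_adjointField_eq`). On the support of $K$ one has $|r|\le1$. If $|\nabla
s|\le L$ and $\int_\Omega K(x,y)\,dx\le A$ for all $y\in\Omega$, then $|\Psi|\le A(1+L)$, and
`totalVariation_average_le` gives $|D(Tf)|(\Omega)\le A(1+L)|Df|(\Omega)$.

The gradient bound of $\eta/n$ is $L/n\to0$. Once it is below $1$, $A$ can be taken as
$|B_1|(\int\rho)^{-1}((1+L/n)/(1-L/n))^N$ (`massBound_of_lt_one`). For the remaining $n$ a finite
$A$ comes from comparing $\eta$ with $\sigma^2$ (`exists_massBound`).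

Convergence in $L^1$ follows from density of $C_c$ and the uniform bound on $A$
(`tendstoL1_average`). In (i) the variations stay bounded, and density of test functions in
$C_0(\Omega)$ gives weak* convergence. In (ii) $\int\rho_n\to|B_1|$, so the factor $A(1+L/n)$ tends
to $1$; with lower semicontinuity the variations converge. The measures $Du$ are produced from the
finite variation by Hahn–Banach and Riesz–Markov–Kakutani (`exists_measures_of_bounded`). -/

namespace BVMollifier

noncomputable section

open scoped CompactlySupported

/-! ### Representation of bounded functionals by differences of finite measures -/

section Riesz

variable {X : Type*} [TopologicalSpace X]

/-- The supremum of the positive parts of two compactly supported functions. -/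
def supPos (p : C_c(X, ℝ) × C_c(X, ℝ)) : ℝ := ⨆ x, max 0 (max (p.1 x) (p.2 x))

lemma exists_forall_le (f : C_c(X, ℝ)) : ∃ B, ∀ x, f x ≤ B := by
  obtain ⟨B, hB⟩ := f.hasCompactSupport.exists_bound_of_continuous f.continuous
  exact ⟨B, fun x => (le_abs_self _).trans (hB x)⟩

lemma bddAbove_supPos (p : C_c(X, ℝ) × C_c(X, ℝ)) :
    BddAbove (Set.range fun x => max 0 (max (p.1 x) (p.2 x))) := by
  obtain ⟨B, hB⟩ := exists_forall_le p.1
  obtain ⟨B', hB'⟩ := exists_forall_le p.2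
  refine ⟨max 0 (max B B'), ?_⟩
  rintro _ ⟨x, rfl⟩
  exact max_le_max le_rfl (max_le_max (hB x) (hB' x))

lemma le_supPos (p : C_c(X, ℝ) × C_c(X, ℝ)) (x : X) :
    max 0 (max (p.1 x) (p.2 x)) ≤ supPos p := le_ciSup (bddAbove_supPos p) x

lemma supPos_nonneg (p : C_c(X, ℝ) × C_c(X, ℝ)) : 0 ≤ supPos p :=
  Real.iSup_nonneg fun _ => le_max_left _ _

lemma supPos_le {p : C_c(X, ℝ) × C_c(X, ℝ)} {B : ℝ} (hB : 0 ≤ B) (h1 : ∀ x, p.1 x ≤ B)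
    (h2 : ∀ x, p.2 x ≤ B) : supPos p ≤ B :=
  Real.iSup_le (fun x => max_le hB (max_le (h1 x) (h2 x))) hB

lemma supPos_smul {c : ℝ} (hc : 0 < c) (p : C_c(X, ℝ) × C_c(X, ℝ)) :
    supPos (c • p) = c * supPos p := by
  unfold supPos
  rw [Real.mul_iSup_of_nonneg hc.le]
  congr 1
  ext x
  simp [mul_max_of_nonneg _ _ hc.le]

lemma supPos_add (p q : C_c(X, ℝ) × C_c(X, ℝ)) : supPos (p + q) ≤ supPos p + supPos q := by
  refine supPos_le (add_nonneg (supPos_nonneg _) (supPos_nonneg _)) (fun x => ?_) fun x => ?_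
  · have h1 := le_supPos p x
    have h2 := le_supPos q x
    simp only [max_le_iff] at h1 h2
    simpa using add_le_add h1.2.1 h2.2.1
  · have h1 := le_supPos p x
    have h2 := le_supPos q x
    simp only [max_le_iff] at h1 h2
    simpa using add_le_add h1.2.2 h2.2.2

variable [T2Space X] [LocallyCompactSpace X] [MeasurableSpace X] [BorelSpace X]

/-- The compact sets of an exhaustion carry mass at most $C$, by Urysohn functions with values in
$[0,1]$. -/
lemma rieszMeasure_univ_le [SigmaCompactSpace X] (P : C_c(X, ℝ) →ₚ[ℝ] ℝ) {C : ℝ}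
    (hP : ∀ f : C_c(X, ℝ), (∀ x, f x ≤ 1) → P f ≤ C) :
    RealRMK.rieszMeasure P Set.univ ≤ ENNReal.ofReal C := by
  have h : ∀ n, RealRMK.rieszMeasure P (compactCovering X n) ≤ ENNReal.ofReal C := by
    intro n
    obtain ⟨f, hf1, hf2, _, hf3⟩ := exists_continuousMap_one_of_isCompact_subset_isOpen
      (isCompact_compactCovering X n) isOpen_univ (Set.subset_univ _)
    exact (RealRMK.rieszMeasure_le_of_eq_one P (f := ⟨f, hf2⟩) (fun x => (hf3 x).1)
      (isCompact_compactCovering X n) hf1).trans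
      (ENNReal.ofReal_le_ofReal (hP _ fun x => (hf3 x).2))
  rw [← iUnion_compactCovering X,
    (show Monotone (compactCovering X) from fun _ _ h => compactCovering_subset X h).measure_iUnion]
  exact iSup_le h

/-- A linear functional on a space of compactly supported functions that is bounded for the
supremum norm is represented by a difference of two finite measures. -/
theorem exists_measures_of_bounded [SigmaCompactSpace X] (S : Submodule ℝ C_c(X, ℝ))
    (l : S →ₗ[ℝ] ℝ) {C : ℝ} (hC : 0 ≤ C)
    (hl : ∀ (φ : S) (B : ℝ), 0 ≤ B → (∀ x, |φ.1 x| ≤ B) → l φ ≤ C * B) :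
    ∃ μ ν : Measure X, IsFiniteMeasure μ ∧ IsFiniteMeasure ν ∧
      μ Set.univ ≤ ENNReal.ofReal C ∧ ν Set.univ ≤ ENNReal.ofReal C ∧
      ∀ φ : S, l φ = ∫ x, φ.1 x ∂μ - ∫ x, φ.1 x ∂ν := by
  -- Embed $S$ by $\varphi\mapsto(\varphi,-\varphi)$ and extend $l$ to pairs, dominated by $C$ times
  -- `supPos`. The two components of the extension play the roles of positive and negative parts.
  let j : S →ₗ[ℝ] C_c(X, ℝ) × C_c(X, ℝ) := S.subtype.prod (-S.subtype)
  have hj : Function.Injective j := fun a b hab => by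
    have := congrArg Prod.fst hab
    simpa [j] using this
  let e := LinearEquiv.ofInjective j hj
  obtain ⟨F, hF, hFN⟩ := exists_extension_of_le_sublinear
    (⟨LinearMap.range j, l ∘ₗ e.symm.toLinearMap⟩ : (C_c(X, ℝ) × C_c(X, ℝ)) →ₗ.[ℝ] ℝ)
    (fun p => C * supPos p) (fun c hc p => by simp only [supPos_smul hc]; ring)
    (fun p q => by rw [← mul_add]; exact mul_le_mul_of_nonneg_left (supPos_add p q) hC) (by
      intro p
      obtain ⟨φ, rfl⟩ := e.surjective p
      change l (e.symm (e φ)) ≤ C * supPos (j φ)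
      rw [e.symm_apply_apply]
      refine hl φ _ (supPos_nonneg _) fun x => ?_
      have := le_supPos (j φ) x
      simp only [max_le_iff] at this
      exact abs_le'.2 ⟨this.2.1, this.2.2⟩)
  -- `supPos` is $0$ on pairs of nonpositive functions, so domination alone makes both components of
  -- $F$ positive functionals.
  have hneg : ∀ p : C_c(X, ℝ) × C_c(X, ℝ), (∀ x, p.1 x ≤ 0) → (∀ x, p.2 x ≤ 0) → F p ≤ 0 := by
    intro p h1 h2
    refine (hFN p).trans ?_
    exact mul_nonpos_of_nonneg_of_nonpos hC (supPos_le le_rfl h1 h2)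
  let P : C_c(X, ℝ) →ₚ[ℝ] ℝ := PositiveLinearMap.mk₀ (F ∘ₗ LinearMap.inl ℝ _ _) (by
    intro f hf
    have := hneg (-f, 0) (fun x => by simpa using hf x) (fun x => by simp)
    have h2 : F (-f, 0) = - F (f, 0) := by rw [← map_neg]; simp
    simp only [LinearMap.comp_apply, LinearMap.inl_apply]
    linarith)
  let Q : C_c(X, ℝ) →ₚ[ℝ] ℝ := PositiveLinearMap.mk₀ (F ∘ₗ LinearMap.inr ℝ _ _) (by
    intro f hf
    have := hneg (0, -f) (fun x => by simp) (fun x => by simpa using hf x)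
    have h2 : F (0, -f) = - F (0, f) := by rw [← map_neg]; simp
    simp only [LinearMap.comp_apply, LinearMap.inr_apply]
    linarith)
  have hPf : ∀ f, P f = F (f, 0) := fun f => rfl
  have hQf : ∀ f, Q f = F (0, f) := fun f => rfl
  have hPC : RealRMK.rieszMeasure P Set.univ ≤ ENNReal.ofReal C := by
    refine rieszMeasure_univ_le P fun f hf => ?_
    rw [hPf]
    refine (hFN _).trans (mul_le_of_le_one_right hC (supPos_le zero_le_one hf fun x => ?_))
    simp
  have hQC : RealRMK.rieszMeasure Q Set.univ ≤ ENNReal.ofReal C := by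
    refine rieszMeasure_univ_le Q fun f hf => ?_
    rw [hQf]
    refine (hFN _).trans (mul_le_of_le_one_right hC (supPos_le zero_le_one (fun x => ?_) hf))
    simp
  refine ⟨RealRMK.rieszMeasure P, RealRMK.rieszMeasure Q, ⟨hPC.trans_lt ENNReal.ofReal_lt_top⟩,
    ⟨hQC.trans_lt ENNReal.ofReal_lt_top⟩, hPC, hQC, fun φ => ?_⟩
  rw [RealRMK.integral_rieszMeasure, RealRMK.integral_rieszMeasure, hPf, hQf]
  have h1 : F (j φ) = l φ := by
    have := hF (e φ)
    change F (j φ) = l (e.symm (e φ)) at this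
    rwa [e.symm_apply_apply] at this
  have h2 : j φ = (φ.1, 0) - (0, φ.1) := by
    ext <;> simp [j]
  rw [← h1, h2, map_sub]

end Riesz

/-! ### Test functions, variation, and the derivative measure -/

section Variation

variable {N : ℕ} {Ω : Set (Eu N)} {u : Eu N → ℝ}

lemma IsTestFunction.const_smul {F : Type*} [NormedAddCommGroup F] [NormedSpace ℝ F]
    {φ : Eu N → F} (hφ : IsTestFunction Ω φ) (c : ℝ) : IsTestFunction Ω (c • φ) where
  smooth := contDiff_const.smul hφ.smooth
  compact_supp := hφ.compact_supp.smul_left (f := fun _ => c)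
  supp_subset := (closure_mono (Function.support_const_smul_subset c φ)).trans hφ.supp_subset

lemma IsTestFunction.add {F : Type*} [NormedAddCommGroup F] [NormedSpace ℝ F]
    {φ ψ : Eu N → F} (hφ : IsTestFunction Ω φ) (hψ : IsTestFunction Ω ψ) :
    IsTestFunction Ω (φ + ψ) where
  smooth := hφ.smooth.add hψ.smooth
  compact_supp := hφ.compact_supp.add hψ.compact_supp
  supp_subset := (tsupport_add φ ψ).trans (Set.union_subset hφ.supp_subset hψ.supp_subset)

lemma isTestFunction_zero {F : Type*} [NormedAddCommGroup F] [NormedSpace ℝ F] :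
    IsTestFunction Ω (0 : Eu N → F) where
  smooth := contDiff_const
  compact_supp := HasCompactSupport.zero
  supp_subset := by simp [tsupport]

lemma differentiable_coord {φ : Eu N → Eu N} (hφ : ContDiff ℝ ∞ φ) (i : Fin N) :
    Differentiable ℝ fun y => φ y i :=
  fun x => (differentiableAt_euclidean.1 (hφ.differentiable (by simp) x)) i

lemma partialDeriv_eq_fderiv {φ : Eu N → Eu N} (hφ : ContDiff ℝ ∞ φ) (i j : Fin N) (x : Eu N) :
    partialDeriv j (fun y => φ y i) x = fderiv ℝ φ x (EuclideanSpace.single j 1) i := by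
  have h := (EuclideanSpace.proj i : Eu N →L[ℝ] ℝ).hasFDerivAt.comp x
    (hφ.differentiable (by simp) x).hasFDerivAt
  rw [partialDeriv]
  exact congrArg (fun T => T (EuclideanSpace.single j (1 : ℝ))) h.fderiv

lemma divergence_const_smul {φ : Eu N → Eu N} (hφ : ContDiff ℝ ∞ φ) (c : ℝ) (x : Eu N) :
    divergence (c • φ) x = c * divergence φ x := by
  simp only [divergence, Finset.mul_sum, partialDeriv]
  refine Finset.sum_congr rfl fun i _ => ?_
  have : (fun y => (c • φ) y i) = fun y => c * φ y i := by ext y; simp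
  rw [this, fderiv_const_mul (differentiable_coord hφ i x)]
  simp

lemma ofReal_integral_le_totalVariation {φ : Eu N → Eu N} (hφ : IsTestFunction Ω φ)
    (h1 : ∀ x, ‖φ x‖ ≤ 1) :
    ENNReal.ofReal (∫ x in Ω, u x * divergence φ x) ≤ totalVariation Ω u :=
  le_iSup_of_le φ (le_iSup_of_le hφ (le_iSup_of_le h1 le_rfl))

lemma integral_mul_divergence_le (hu : totalVariation Ω u < ⊤) {φ : Eu N → Eu N}
    (hφ : IsTestFunction Ω φ) {C : ℝ} (hC : 0 ≤ C) (hφC : ∀ x, ‖φ x‖ ≤ C) :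
    ∫ x in Ω, u x * divergence φ x ≤ (totalVariation Ω u).toReal * C := by
  rcases hC.eq_or_lt with rfl | hC
  · have : φ = 0 := funext fun x => norm_le_zero_iff.1 (hφC x)
    subst this
    simp [divergence, partialDeriv]
  · have h := ofReal_integral_le_totalVariation (u := u) (hφ.const_smul C⁻¹) (fun x => by
      rw [Pi.smul_apply, norm_smul, norm_inv, Real.norm_of_nonneg hC.le, inv_mul_le_iff₀ hC]
      simpa using hφC x)
    rw [ENNReal.ofReal_le_iff_le_toReal hu.ne] at h
    have h2 : ∫ x in Ω, u x * divergence (C⁻¹ • φ) x = C⁻¹ * ∫ x in Ω, u x * divergence φ x := by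
      rw [← integral_const_mul]
      congr 1; ext x
      rw [divergence_const_smul hφ.smooth]; ring
    rw [h2, inv_mul_le_iff₀ hC] at h
    linarith

lemma divergence_smul_single (φ : Eu N → ℝ) (i : Fin N) (x : Eu N) :
    divergence (fun y => φ y • EuclideanSpace.single i (1 : ℝ)) x = partialDeriv i φ x := by
  rw [divergence, Finset.sum_eq_single i]
  · simp
  · intro j _ hj
    simp [partialDeriv, hj]
  · simp

lemma IsTestFunction.smul_single {φ : Eu N → ℝ} (hφ : IsTestFunction Ω φ) (i : Fin N) :
    IsTestFunction Ω (fun y => φ y • EuclideanSpace.single i (1 : ℝ)) where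
  smooth := hφ.smooth.smul contDiff_const
  compact_supp := hφ.compact_supp.smul_right (f' := fun _ => EuclideanSpace.single i (1 : ℝ))
  supp_subset := (closure_mono (Function.support_smul_subset_left _ _)).trans hφ.supp_subset

lemma continuous_partialDeriv {φ : Eu N → ℝ} (hφ : ContDiff ℝ ∞ φ) (i : Fin N) :
    Continuous (partialDeriv i φ) :=
  (hφ.continuous_fderiv (by simp)).clm_apply continuous_const

lemma hasCompactSupport_partialDeriv {φ : Eu N → ℝ} (hφ : HasCompactSupport φ) (i : Fin N) :
    HasCompactSupport (partialDeriv i φ) :=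
  hφ.fderiv_apply (𝕜 := ℝ) _

lemma integrableOn_mul_partialDeriv (hu : IntegrableOn u Ω) {φ : Eu N → ℝ}
    (hφ : IsTestFunction Ω φ) (i : Fin N) :
    IntegrableOn (fun x => u x * partialDeriv i φ x) Ω := by
  obtain ⟨B, hB⟩ := (hasCompactSupport_partialDeriv hφ.compact_supp i).exists_bound_of_continuous
    (continuous_partialDeriv hφ.smooth i)
  exact hu.mul_bdd (continuous_partialDeriv hφ.smooth i).aestronglyMeasurable (ae_of_all _ hB)

/-- The test functions in `Ω`, as a subspace of the compactly supported functions. -/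
def testSubmodule (Ω : Set (Eu N)) : Submodule ℝ C_c(Eu N, ℝ) where
  carrier := {φ | IsTestFunction Ω φ}
  add_mem' ha hb := ha.add hb
  zero_mem' := isTestFunction_zero
  smul_mem' c _ ha := ha.const_smul c

lemma partialDeriv_add {φ ψ : Eu N → ℝ} (hφ : ContDiff ℝ ∞ φ) (hψ : ContDiff ℝ ∞ ψ) (i : Fin N)
    (x : Eu N) : partialDeriv i (φ + ψ) x = partialDeriv i φ x + partialDeriv i ψ x := by
  simp [partialDeriv, fderiv_add (hφ.differentiable (by simp) x) (hψ.differentiable (by simp) x)]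

lemma partialDeriv_const_smul {φ : Eu N → ℝ} (hφ : ContDiff ℝ ∞ φ) (c : ℝ) (i : Fin N)
    (x : Eu N) : partialDeriv i (c • φ) x = c * partialDeriv i φ x := by
  simp [partialDeriv, fderiv_const_smul (hφ.differentiable (by simp) x)]

/-- A function of bounded variation has a derivative measure, and its pairing with continuous
functions is controlled by the total variation. -/
theorem IsBV.exists_isDerivMeasure (hu : IsBV Ω u) :
    ∃ μ : Fin N → SignedMeasure (Eu N), IsDerivMeasure Ω u μ ∧
      ∀ (i : Fin N) (φ ψ : C₀(Eu N, ℝ)) (B : ℝ), (∀ x, |φ x - ψ x| ≤ B) →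
        |∫ᵛ x, φ x ∂•μ i - ∫ᵛ x, ψ x ∂•μ i| ≤ 2 * (totalVariation Ω u).toReal * B := by
  set C := (totalVariation Ω u).toReal with hC
  have key : ∀ i : Fin N, ∃ μ ν : Measure (Eu N), IsFiniteMeasure μ ∧ IsFiniteMeasure ν ∧
      μ Set.univ ≤ ENNReal.ofReal C ∧ ν Set.univ ≤ ENNReal.ofReal C ∧
      ∀ φ : Eu N → ℝ, IsTestFunction Ω φ →
        ∫ x in Ω, u x * partialDeriv i φ x = -(∫ x, φ x ∂μ - ∫ x, φ x ∂ν) := by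
    intro i
    let l : testSubmodule Ω →ₗ[ℝ] ℝ :=
      { toFun := fun φ => -∫ x in Ω, u x * partialDeriv i φ.1 x
        map_add' := fun φ ψ => by
          rw [← neg_add, ← integral_add (integrableOn_mul_partialDeriv hu.1 φ.2 i)
            (integrableOn_mul_partialDeriv hu.1 ψ.2 i)]
          congr 2; ext x
          rw [← mul_add, ← partialDeriv_add φ.2.smooth ψ.2.smooth]; rfl
        map_smul' := fun c φ => by
          rw [RingHom.id_apply, smul_eq_mul, mul_neg, ← integral_const_mul]
          congr 2; ext x
          rw [mul_left_comm, ← partialDeriv_const_smul φ.2.smooth]; rfl }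
    obtain ⟨μ, ν, h1, h2, h3, h4, h5⟩ := exists_measures_of_bounded (testSubmodule Ω) l
      ENNReal.toReal_nonneg (C := C) (by
        intro φ B hB hφB
        have hs : IsTestFunction Ω (-1 • (φ.1 : Eu N → ℝ)) := by
          simpa using φ.2.const_smul (-1)
        have := integral_mul_divergence_le hu.2 (hs.smul_single i) hB (fun x => by
          simpa [norm_smul] using hφB x)
        simp_rw [divergence_smul_single] at this
        convert this using 1
        change -∫ x in Ω, u x * partialDeriv i φ.1 x = _
        rw [← integral_neg]
        congr 1; ext x
        have h := partialDeriv_const_smul φ.2.smooth (-1) i x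
        simp only [neg_smul, one_smul] at h ⊢
        rw [h]; ring)
    refine ⟨μ, ν, h1, h2, h3, h4, fun φ hφ => ?_⟩
    have := h5 ⟨⟨⟨φ, hφ.smooth.continuous⟩, hφ.compact_supp⟩, hφ⟩
    change -∫ x in Ω, u x * partialDeriv i φ x = ∫ x, φ x ∂μ - ∫ x, φ x ∂ν at this
    rw [← this, neg_neg]
  choose μ ν hμf hνf hμ hν hμν using key
  have hint : ∀ (i : Fin N) (φ : Eu N → ℝ), Continuous φ → (∃ B, ∀ x, ‖φ x‖ ≤ B) →
      Integrable φ ((μ i).restrict Ω) ∧ Integrable φ ((ν i).restrict Ω) := by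
    rintro i φ hφ ⟨B, hB⟩
    exact ⟨.of_bound hφ.aestronglyMeasurable B (ae_of_all _ hB),
      .of_bound hφ.aestronglyMeasurable B (ae_of_all _ hB)⟩
  have hform : ∀ (i : Fin N) (φ : Eu N → ℝ), Continuous φ → (∃ B, ∀ x, ‖φ x‖ ≤ B) →
      ∫ᵛ x, φ x ∂•(((μ i).restrict Ω).toSignedMeasure - ((ν i).restrict Ω).toSignedMeasure) =
        ∫ x in Ω, φ x ∂(μ i) - ∫ x in Ω, φ x ∂(ν i) := by
    intro i φ hφ hB
    -- Real multiplication is symmetric, so the pairing may be replaced by its flip.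
    have hflip : (ContinuousLinearMap.lsmul ℝ ℝ : ℝ →L[ℝ] ℝ →L[ℝ] ℝ) =
        (ContinuousLinearMap.lsmul ℝ ℝ).flip := by ext; simp
    rw [hflip, VectorMeasure.integral_sub_vectorMeasure, VectorMeasure.integral_toSignedMeasure,
      VectorMeasure.integral_toSignedMeasure]
    · simpa [VectorMeasure.Integrable] using (hint i φ hφ hB).1
    · simpa [VectorMeasure.Integrable] using (hint i φ hφ hB).2
  -- Restriction to `Ω` concentrates the measures there and does not change integrals of test
  -- functions.
  refine ⟨fun i => ((μ i).restrict Ω).toSignedMeasure - ((ν i).restrict Ω).toSignedMeasure,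
    ⟨fun i A hA hAΩ => ?_, fun i φ hφ => ?_⟩, fun i φ ψ B hB => ?_⟩
  · have h0 : A ∩ Ω = ∅ := by
      ext x; simp only [Set.mem_inter_iff, Set.mem_empty_iff_false, iff_false, not_and]
      exact fun h => hAΩ h
    simp [Measure.toSignedMeasure_sub_apply hA, Measure.real, Measure.restrict_apply hA, h0]
  · rw [hform i φ hφ.smooth.continuous
      (hφ.compact_supp.exists_bound_of_continuous hφ.smooth.continuous), hμν i φ hφ]
    have hsub : ∀ x ∉ Ω, φ x = 0 := fun x hx =>
      image_eq_zero_of_notMem_tsupport fun h => hx (hφ.supp_subset h)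
    rw [setIntegral_eq_integral_of_forall_compl_eq_zero hsub,
      setIntegral_eq_integral_of_forall_compl_eq_zero hsub]
  -- The factor 2 counts the two measures, each of mass at most `C`.
  · have hbd : ∀ φ : C₀(Eu N, ℝ), ∃ B, ∀ x, ‖φ x‖ ≤ B := fun φ =>
      ⟨‖φ.toBCF‖, fun x => φ.toBCF.norm_coe_le_norm x⟩
    have hsm : ∀ (m : Measure (Eu N)), IsFiniteMeasure m → m Set.univ ≤ ENNReal.ofReal C →
        |∫ x in Ω, (φ x - ψ x) ∂m| ≤ B * C := by
      intro m _ hm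
      have hB0 : 0 ≤ B := (abs_nonneg _).trans (hB 0)
      have h1 : ‖∫ x in Ω, (φ x - ψ x) ∂m‖ ≤ B * (m.restrict Ω).real Set.univ :=
        norm_integral_le_of_norm_le_const (ae_of_all _ hB)
      refine h1.trans ?_
      refine mul_le_mul_of_nonneg_left ?_ hB0
      refine ENNReal.toReal_le_of_le_ofReal ENNReal.toReal_nonneg ?_
      rw [Measure.restrict_apply_univ]
      exact (measure_mono (Set.subset_univ _)).trans hm
    rw [hform i φ φ.continuous (hbd φ), hform i ψ ψ.continuous (hbd ψ)]
    have h1 := hsm (μ i) (hμf i) (hμ i)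
    have h2 := hsm (ν i) (hνf i) (hν i)
    rw [integral_sub (hint i φ φ.continuous (hbd φ)).1 (hint i ψ ψ.continuous (hbd ψ)).1] at h1
    rw [integral_sub (hint i φ φ.continuous (hbd φ)).2 (hint i ψ ψ.continuous (hbd ψ)).2] at h2
    rw [abs_le] at h1 h2 ⊢
    constructor <;> linarith [h1.1, h1.2, h2.1, h2.2]

end Variation

/-! ### Smooth dependence of integrals on a parameter -/

section ParametricIntegral

variable {E P F : Type*} [NormedAddCommGroup E] [NormedSpace ℝ E] [MeasurableSpace E]
  [BorelSpace E] [FiniteDimensional ℝ E] [NormedAddCommGroup P] [NormedSpace ℝ P]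
  [NormedAddCommGroup F] [NormedSpace ℝ F] {μ : Measure E}
  [μ.IsAddHaarMeasure] {H : P × E → F}

/-- The derivative is bounded, and for every parameter it vanishes off the projection of the support
of `H`; a constant on that compact set dominates. -/
lemma hasFDerivAt_integral_of_hasCompactSupport (hH : ContDiff ℝ ∞ H) (hc : HasCompactSupport H)
    (p : P) :
    Integrable (fun x => (fderiv ℝ H (p, x)).comp (ContinuousLinearMap.inl ℝ P E)) μ ∧
    HasFDerivAt (fun p => ∫ x, H (p, x) ∂μ)
      (∫ x, (fderiv ℝ H (p, x)).comp (ContinuousLinearMap.inl ℝ P E) ∂μ) p := by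
  have hd : Continuous fun q => (fderiv ℝ H q).comp (ContinuousLinearMap.inl ℝ P E) :=
    (hH.continuous_fderiv (by simp)).clm_comp continuous_const
  have hdc : HasCompactSupport fun q => (fderiv ℝ H q).comp (ContinuousLinearMap.inl ℝ P E) :=
    (hc.fderiv ℝ).comp_left (g := fun T : P × E →L[ℝ] F =>
      T.comp (ContinuousLinearMap.inl ℝ P E)) (by simp)
  obtain ⟨B, hB⟩ := hdc.exists_bound_of_continuous hd
  set K := Prod.snd '' tsupport H with hK
  have hKc : IsCompact K := hc.image continuous_snd
  have hzero : ∀ p x, x ∉ K → (fderiv ℝ H (p, x)).comp (ContinuousLinearMap.inl ℝ P E) = 0 := by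
    intro p x hx
    have : (p, x) ∉ tsupport (fderiv ℝ H) := fun h =>
      hx ⟨(p, x), tsupport_fderiv_subset ℝ h, rfl⟩
    rw [image_eq_zero_of_notMem_tsupport this]
    simp
  have hbound : ∀ p x, ‖(fderiv ℝ H (p, x)).comp (ContinuousLinearMap.inl ℝ P E)‖ ≤
      K.indicator (fun _ => B) x := by
    intro p x
    by_cases hx : x ∈ K
    · simpa [hx] using hB (p, x)
    · simp [hx, hzero p x hx]
  have hBint : Integrable (K.indicator fun _ => B) μ :=
    (integrableOn_const hKc.measure_lt_top.ne).integrable_indicator hKc.measurableSet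
  have hcont : ∀ p, Continuous fun x => H (p, x) := fun p => hH.continuous.comp (by fun_prop)
  have hm : Continuous fun x => (fderiv ℝ H (p, x)).comp (ContinuousLinearMap.inl ℝ P E) :=
    hd.comp (by fun_prop)
  refine ⟨hBint.mono' hm.aestronglyMeasurable (ae_of_all _ (hbound p)), ?_⟩
  refine hasFDerivAt_integral_of_dominated_of_fderiv_le (s := Set.univ)
    (F' := fun p x => (fderiv ℝ H (p, x)).comp (ContinuousLinearMap.inl ℝ P E)) univ_mem ?_ ?_ ?_
    (ae_of_all _ fun x p _ => hbound p x) hBint ?_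
  · exact .of_forall fun p => (hcont p).aestronglyMeasurable
  · refine (hcont p).integrable_of_hasCompactSupport (HasCompactSupport.intro hKc fun x hx => ?_)
    exact image_eq_zero_of_notMem_tsupport fun h => hx ⟨(p, x), h, rfl⟩
  · exact hm.aestronglyMeasurable
  · refine ae_of_all _ fun x p _ => ?_
    exact (hH.differentiable (by simp) (p, x)).hasFDerivAt.comp p (hasFDerivAt_prodMk_left p x)

/-- The integral is a convolution with the constant $1$, evaluated at $0$, so smoothness of
convolutions with parameters applies. -/
lemma contDiff_integral_of_hasCompactSupport [CompleteSpace F]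
    (hH : ContDiff ℝ ∞ H) (hc : HasCompactSupport H) : ContDiff ℝ ∞ fun p => ∫ x, H (p, x) ∂μ := by
  have h := contDiffOn_convolution_right_with_param (μ := μ) (n := ⊤)
    (f := fun _ : E => (1 : ℝ)) (ContinuousLinearMap.lsmul ℝ ℝ : ℝ →L[ℝ] F →L[ℝ] F)
    (g := fun p x => H (p, x)) (s := Set.univ) isOpen_univ
    (hc.image continuous_snd) (fun p x _ hx => image_eq_zero_of_notMem_tsupport fun h =>
      hx ⟨(p, x), h, rfl⟩) (locallyIntegrable_const 1) hH.contDiffOn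
  rw [Set.univ_prod_univ, contDiffOn_univ] at h
  have h2 := h.comp (contDiff_prodMk_left (0 : E) (𝕜 := ℝ) (E := P))
  convert h2 using 2 with p
  simp only [Function.comp, convolution, ContinuousLinearMap.lsmul_apply, one_smul, zero_sub]
  exact (integral_neg_eq_self (fun x => H (p, x)) μ).symm

end ParametricIntegral

/-! ### The averaging kernel and its adjoint on vector fields -/

/-- A smooth kernel with values in `[0, 1]` that is supported in the closed unit ball. -/
structure IsBump {N : ℕ} (ρ : Eu N → ℝ) : Prop where
  smooth : ContDiff ℝ ∞ ρ
  nonneg : ∀ x, 0 ≤ ρ x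
  le_one : ∀ x, ρ x ≤ 1
  eq_zero : ∀ x, 1 ≤ ‖x‖ → ρ x = 0
  integral_pos : 0 < ∫ x, ρ x

/-- A smooth positive radius function on `Ω` for averages over balls contained in `Ω`. -/
structure IsRadius {N : ℕ} (Ω : Set (Eu N)) (L : ℝ) (s : Eu N → ℝ) : Prop where
  smooth : ContDiffOn ℝ ∞ s Ω
  grad_bounded : ∀ x ∈ Ω, ‖fderiv ℝ s x‖ ≤ L
  pos : ∀ x ∈ Ω, 0 < s x
  closedBall_subset : ∀ x ∈ Ω, Metric.closedBall x (s x) ⊆ Ω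

section Kernel

variable {N : ℕ} {Ω : Set (Eu N)} {ρ s : Eu N → ℝ} {L : ℝ}

/-- The kernel `ρ((x - y) / s(x))`, normalized to have integral one in `y`. -/
def avgKernel (ρ s : Eu N → ℝ) (x y : Eu N) : ℝ :=
  (∫ z, ρ z)⁻¹ * ((s x)⁻¹ ^ N * ρ ((s x)⁻¹ • (x - y)))

/-- The average of `f` with respect to `avgKernel`. -/
def average (Ω : Set (Eu N)) (ρ s f : Eu N → ℝ) (x : Eu N) : ℝ :=
  ∫ y in Ω, avgKernel ρ s x y * f y

/-- The kernel of the adjoint operator on vector fields. -/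
def fieldKernel (ρ s : Eu N → ℝ) (φ : Eu N → Eu N) (q : Eu N × Eu N) : Eu N :=
  avgKernel ρ s q.2 q.1 • (φ q.2 - fderiv ℝ s q.2 (φ q.2) • ((s q.2)⁻¹ • (q.2 - q.1)))

/-- The vector field whose divergence is the adjoint of the averaging operator applied to
`div φ`. -/
def adjointField (ρ s : Eu N → ℝ) (φ : Eu N → Eu N) (y : Eu N) : Eu N :=
  ∫ x, fieldKernel ρ s φ (y, x)

lemma IsBump.avgKernel_nonneg (hρ : IsBump ρ) (hs : IsRadius Ω L s) {x : Eu N} (hx : x ∈ Ω)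
    (y : Eu N) : 0 ≤ avgKernel ρ s x y := by
  have := hs.pos x hx
  have := hρ.integral_pos
  have := hρ.nonneg ((s x)⁻¹ • (x - y))
  unfold avgKernel
  positivity

lemma IsBump.avgKernel_eq_zero (hρ : IsBump ρ) {x y : Eu N} (hx : 0 < s x)
    (h : s x ≤ ‖x - y‖) : avgKernel ρ s x y = 0 := by
  rw [avgKernel, hρ.eq_zero, mul_zero, mul_zero]
  rw [norm_smul, norm_inv, Real.norm_of_nonneg hx.le, le_inv_mul_iff₀ hx]
  simpa using h

lemma IsBump.contDiffAt_avgKernel (hΩ : IsOpen Ω) (hρ : IsBump ρ) (hs : IsRadius Ω L s)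
    {q : Eu N × Eu N} (hq : q.2 ∈ Ω) :
    ContDiffAt ℝ ∞ (fun q : Eu N × Eu N => avgKernel ρ s q.2 q.1) q := by
  have h1 : ContDiffAt ℝ ∞ (fun q : Eu N × Eu N => (s q.2)⁻¹) q :=
    ((hs.smooth.contDiffAt (hΩ.mem_nhds hq)).comp q contDiffAt_snd).inv (hs.pos _ hq).ne'
  unfold avgKernel
  refine contDiffAt_const.mul ((h1.pow N).mul (hρ.smooth.contDiffAt.comp q (h1.smul ?_)))
  exact contDiffAt_snd.sub contDiffAt_fst

lemma IsBump.contDiffAt_avgKernel_left (hΩ : IsOpen Ω) (hρ : IsBump ρ) (hs : IsRadius Ω L s)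
    {x : Eu N} (hx : x ∈ Ω) (y : Eu N) : ContDiffAt ℝ ∞ (fun x => avgKernel ρ s x y) x :=
  (hρ.contDiffAt_avgKernel hΩ hs (q := (y, x)) hx).comp x (contDiffAt_const.prodMk contDiffAt_id)

variable {φ : Eu N → Eu N}

/-- The compact set outside of which `fieldKernel` vanishes. -/
def fieldSupport (s : Eu N → ℝ) (φ : Eu N → Eu N) : Set (Eu N × Eu N) :=
  (fun q : Eu N × Eu N => (q.1 - s q.1 • q.2, q.1)) '' (tsupport φ ×ˢ Metric.closedBall 0 1)

lemma isCompact_fieldSupport (hs : IsRadius Ω L s) (hφ : IsTestFunction Ω φ) :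
    IsCompact (fieldSupport s φ) := by
  refine (hφ.compact_supp.prod (isCompact_closedBall _ _)).image_of_continuousOn ?_
  have h1 : ContinuousOn (fun q : Eu N × Eu N => s q.1) (tsupport φ ×ˢ Metric.closedBall 0 1) :=
    hs.smooth.continuousOn.comp continuousOn_fst fun q hq => hφ.supp_subset hq.1
  exact (continuousOn_fst.sub (h1.smul continuousOn_snd)).prodMk continuousOn_fst

lemma mem_of_mem_fieldSupport (hs : IsRadius Ω L s) (hφ : IsTestFunction Ω φ)
    {q : Eu N × Eu N} (hq : q ∈ fieldSupport s φ) : q.1 ∈ Ω ∧ q.2 ∈ Ω := by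
  obtain ⟨⟨x, z⟩, ⟨hx, hz⟩, rfl⟩ := hq
  have hxΩ := hφ.supp_subset hx
  refine ⟨hs.closedBall_subset x hxΩ ?_, hxΩ⟩
  have := hs.pos x hxΩ
  simp only [mem_closedBall_zero_iff] at hz
  simp only [Metric.mem_closedBall, dist_eq_norm, sub_sub_cancel_left, norm_neg, norm_smul,
    Real.norm_of_nonneg this.le]
  nlinarith

lemma fieldKernel_eq_zero (hρ : IsBump ρ) (hs : IsRadius Ω L s) (hφ : IsTestFunction Ω φ)
    {q : Eu N × Eu N} (hq : q ∉ fieldSupport s φ) : fieldKernel ρ s φ q = 0 := by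
  by_cases hx : q.2 ∈ tsupport φ
  · have hpos := hs.pos _ (hφ.supp_subset hx)
    rw [fieldKernel, hρ.avgKernel_eq_zero hpos, zero_smul]
    by_contra! h
    refine hq ⟨(q.2, (s q.2)⁻¹ • (q.2 - q.1)), ⟨hx, ?_⟩, ?_⟩
    · rw [mem_closedBall_zero_iff, norm_smul, norm_inv, Real.norm_of_nonneg hpos.le,
        inv_mul_le_iff₀ hpos]
      simpa using h.le
    · simp [smul_smul, hpos.ne']
  · simp [fieldKernel, image_eq_zero_of_notMem_tsupport hx]

lemma hasCompactSupport_fieldKernel (hρ : IsBump ρ) (hs : IsRadius Ω L s)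
    (hφ : IsTestFunction Ω φ) : HasCompactSupport (fieldKernel ρ s φ) :=
  HasCompactSupport.intro (isCompact_fieldSupport hs hφ) fun _ hq =>
    fieldKernel_eq_zero hρ hs hφ hq

/-- `s` is smooth and positive only on `Ω`. The support of the kernel is a compact set on which
$x\in\Omega$, and off it the kernel is locally zero. -/
lemma contDiff_fieldKernel (hΩ : IsOpen Ω) (hρ : IsBump ρ) (hs : IsRadius Ω L s)
    (hφ : IsTestFunction Ω φ) : ContDiff ℝ ∞ (fieldKernel ρ s φ) := by
  refine contDiff_iff_contDiffAt.2 fun q => ?_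
  by_cases hq : q ∈ tsupport (fieldKernel ρ s φ)
  swap
  · exact contDiffAt_const.congr_of_eventuallyEq (notMem_tsupport_iff_eventuallyEq.1 hq)
  have hsub : tsupport (fieldKernel ρ s φ) ⊆ fieldSupport s φ :=
    closure_minimal (fun q hq => by
      by_contra h
      exact hq (fieldKernel_eq_zero hρ hs hφ h)) (isCompact_fieldSupport hs hφ).isClosed
  have hqΩ := (mem_of_mem_fieldSupport hs hφ (hsub hq)).2
  have hsq : ContDiffAt ℝ ∞ s q.2 := hs.smooth.contDiffAt (hΩ.mem_nhds hqΩ)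
  have h1 : ContDiffAt ℝ ∞ (fun q : Eu N × Eu N => (s q.2)⁻¹) q :=
    (hsq.comp q contDiffAt_snd).inv (hs.pos _ hqΩ).ne'
  have h2 : ContDiffAt ℝ ∞ (fun q : Eu N × Eu N => φ q.2) q :=
    hφ.smooth.contDiffAt.comp q contDiffAt_snd
  have h3 : ContDiffAt ℝ ∞ (fun q : Eu N × Eu N => fderiv ℝ s q.2) q :=
    (hsq.fderiv_right (m := ∞) (by simp)).comp q contDiffAt_snd
  exact (hρ.contDiffAt_avgKernel hΩ hs hqΩ).smul
    (h2.sub ((h3.clm_apply h2).smul (h1.smul (contDiffAt_snd.sub contDiffAt_fst))))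

lemma isTestFunction_adjointField (hΩ : IsOpen Ω) (hρ : IsBump ρ) (hs : IsRadius Ω L s)
    (hφ : IsTestFunction Ω φ) : IsTestFunction Ω (adjointField ρ s φ) := by
  have hc : IsCompact (Prod.fst '' fieldSupport s φ) :=
    (isCompact_fieldSupport hs hφ).image continuous_fst
  have hzero : ∀ y ∉ Prod.fst '' fieldSupport s φ, adjointField ρ s φ y = 0 := by
    intro y hy
    rw [adjointField, integral_eq_zero_of_ae (ae_of_all _ fun x => ?_)]
    exact fieldKernel_eq_zero hρ hs hφ fun h => hy ⟨_, h, rfl⟩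
  refine ⟨contDiff_integral_of_hasCompactSupport (contDiff_fieldKernel hΩ hρ hs hφ)
    (hasCompactSupport_fieldKernel hρ hs hφ), HasCompactSupport.intro hc hzero, ?_⟩
  refine (closure_minimal (t := Prod.fst '' fieldSupport s φ) (fun y hy => ?_)
    hc.isClosed).trans ?_
  · by_contra h
    exact hy (hzero y h)
  · rintro _ ⟨q, hq, rfl⟩
    exact (mem_of_mem_fieldSupport hs hφ hq).1

lemma sum_clm_single_mul (T : Eu N →L[ℝ] ℝ) (w : Eu N) :
    ∑ i, T (EuclideanSpace.single i 1) * w i = T w := by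
  conv_rhs => rw [← (EuclideanSpace.basisFun (Fin N) ℝ).sum_repr w]
  simp [map_sum, mul_comm]

lemma fderiv_avgKernel_left (hΩ : IsOpen Ω) (hρ : IsBump ρ) (hs : IsRadius Ω L s)
    {x : Eu N} (hx : x ∈ Ω) (y v : Eu N) :
    fderiv ℝ (fun x => avgKernel ρ s x y) x v =
      (∫ z, ρ z)⁻¹ * ((s x)⁻¹ ^ N * (s x)⁻¹ *
        (fderiv ℝ ρ ((s x)⁻¹ • (x - y)) (v - fderiv ℝ s x v • ((s x)⁻¹ • (x - y))) -
          N * fderiv ℝ s x v * ρ ((s x)⁻¹ • (x - y)))) := by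
  have hpos := hs.pos x hx
  have h1 : HasFDerivAt s (fderiv ℝ s x) x :=
    ((hs.smooth.contDiffAt (hΩ.mem_nhds hx)).differentiableAt (by simp)).hasFDerivAt
  have h2 : HasFDerivAt (fun x => (s x)⁻¹) _ x := (hasDerivAt_inv hpos.ne').comp_hasFDerivAt x h1
  have h3 := h2.pow N
  have h4 := h2.smul ((hasFDerivAt_id x).sub_const y)
  have h5 := ((hρ.smooth.differentiable (by simp) ((s x)⁻¹ • (x - y))).hasFDerivAt).comp x h4
  have h6 := (h3.mul h5).const_mul (∫ z, ρ z)⁻¹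
  have h7 : fderiv ℝ (fun x => avgKernel ρ s x y) x v = _ :=
    congrArg (fun T => T v) h6.fderiv
  rw [h7]
  -- Natural subtraction in the exponent $N-1$ forces the case $N=0$ to be treated apart; there both
  -- sides vanish.
  have hN : (N : ℝ) * (s x)⁻¹ ^ (N - 1) * (s x)⁻¹ = N * (s x)⁻¹ ^ N := by
    rcases Nat.eq_zero_or_pos N with h | h
    · simp [h]
    · rw [mul_assoc, ← pow_succ, Nat.sub_add_cancel h]
  have hq : (s x ^ 2)⁻¹ = (s x)⁻¹ * (s x)⁻¹ := by rw [sq, mul_inv]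
  simp [hq, map_sub, map_smul, smul_smul]
  set c := (s x)⁻¹
  set a := fderiv ℝ s x v
  set R := ρ (c • (x - y))
  linear_combination (-(∫ z, ρ z)⁻¹ * R * a * c) * hN

/-- This cancellation dictates the correction term in `fieldKernel`. Write $a=\nabla s\cdot\phi$.
Moving $x$ along $\phi$ changes $r$ by $(\phi-ar)/s$ and the factor $s^{-N}$ by $-Na\,s^{-N-1}$. The
$y$-divergence of $K(\phi-ar)$ yields the same terms with opposite sign, $N$ being the trace of the
identity. -/
lemma sum_fderiv_fieldKernel (hΩ : IsOpen Ω) (hρ : IsBump ρ) (hs : IsRadius Ω L s)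
    (hφ : IsTestFunction Ω φ) (x y : Eu N) :
    ∑ i : Fin N, (fderiv ℝ (fieldKernel ρ s φ) (y, x)
      (ContinuousLinearMap.inl ℝ _ _ (EuclideanSpace.single i 1))) i =
      - fderiv ℝ (fun x => avgKernel ρ s x y) x (φ x) := by
  have hd : HasFDerivAt (fun y => fieldKernel ρ s φ (y, x))
      ((fderiv ℝ (fieldKernel ρ s φ) (y, x)).comp (ContinuousLinearMap.inl ℝ _ _)) y :=
    HasFDerivAt.comp (g := fieldKernel ρ s φ) y
      ((contDiff_fieldKernel hΩ hρ hs hφ).differentiable (by simp) (y, x)).hasFDerivAt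
      (hasFDerivAt_prodMk_left y x)
  by_cases hx : x ∈ tsupport φ
  · have hxΩ := hφ.supp_subset hx
    have h4 : HasFDerivAt (fun y => (s x)⁻¹ • (x - y))
        ((s x)⁻¹ • (-(ContinuousLinearMap.id ℝ (Eu N)))) y :=
      ((hasFDerivAt_id y).const_sub x).const_smul (s x)⁻¹
    have h5 := ((hρ.smooth.differentiable (by simp) ((s x)⁻¹ • (x - y))).hasFDerivAt).comp y h4
    have h6 := ((h5.const_mul ((s x)⁻¹ ^ N)).const_mul (∫ z, ρ z)⁻¹).smul
      ((h4.const_smul (fderiv ℝ s x (φ x))).const_sub (φ x))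
    have h7 := hd.unique h6
    rw [fderiv_avgKernel_left hΩ hρ hs hxΩ]
    have h8 : ∀ i, (fderiv ℝ (fieldKernel ρ s φ) (y, x)
        (ContinuousLinearMap.inl ℝ _ _ (EuclideanSpace.single i 1))) i = _ := fun i =>
      congrArg (fun T => (T (EuclideanSpace.single i (1 : ℝ))) i) h7
    simp only [h8, Function.comp_apply]
    set r := (s x)⁻¹ • (x - y) with hr
    set a := fderiv ℝ s x (φ x)
    have h9 := sum_clm_single_mul (fderiv ℝ ρ r) (φ x - a • r)
    rw [← h9]
    simp
    rw [Finset.sum_add_distrib, Finset.sum_const, Finset.card_univ, Fintype.card_fin, nsmul_eq_mul,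
      Finset.sum_neg_distrib, mul_sub, mul_sub, neg_sub, sub_eq_add_neg, Finset.mul_sum,
      Finset.mul_sum]
    congr 1
    · ring
    · congr 1
      refine Finset.sum_congr rfl fun i _ => ?_
      simp only [hr, PiLp.smul_apply, PiLp.sub_apply, smul_eq_mul]
      ring
  · have h0 : φ x = 0 := image_eq_zero_of_notMem_tsupport hx
    have : (fun y => fieldKernel ρ s φ (y, x)) = fun _ => 0 := by
      ext1 y; simp [fieldKernel, h0]
    rw [this] at hd
    have h1 := hd.unique (hasFDerivAt_const 0 y)
    rw [h0, map_zero, neg_zero]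
    refine Finset.sum_eq_zero fun i _ => ?_
    have := congrArg (fun T => (T (EuclideanSpace.single i (1 : ℝ))) i) h1
    simpa using this

lemma divergence_adjointField (hΩ : IsOpen Ω) (hρ : IsBump ρ) (hs : IsRadius Ω L s)
    (hφ : IsTestFunction Ω φ) (y : Eu N) :
    divergence (adjointField ρ s φ) y =
      -∫ x, fderiv ℝ (fun x => avgKernel ρ s x y) x (φ x) := by
  obtain ⟨hint, hder⟩ := hasFDerivAt_integral_of_hasCompactSupport (μ := volume)
    (contDiff_fieldKernel hΩ hρ hs hφ) (hasCompactSupport_fieldKernel hρ hs hφ) y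
  let T : (Eu N →L[ℝ] Eu N) →L[ℝ] ℝ := ∑ i : Fin N,
    (EuclideanSpace.proj i : Eu N →L[ℝ] ℝ).comp
      (ContinuousLinearMap.apply ℝ (Eu N) (EuclideanSpace.single i (1 : ℝ)))
  have hT : ∀ A, T A = ∑ i : Fin N, (A (EuclideanSpace.single i 1)) i := by
    intro A
    simp [T]
  have h1 : divergence (adjointField ρ s φ) y = T (fderiv ℝ (adjointField ρ s φ) y) := by
    rw [hT]
    exact Finset.sum_congr rfl fun i _ =>
      partialDeriv_eq_fderiv (isTestFunction_adjointField hΩ hρ hs hφ).smooth i i y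
  have h2 : fderiv ℝ (adjointField ρ s φ) y = _ := hder.fderiv
  rw [h1, h2, ← T.integral_comp_comm hint, ← integral_neg]
  congr 1; ext x
  rw [hT, ← sum_fderiv_fieldKernel hΩ hρ hs hφ x y]
  rfl

lemma integrable_mul_of_continuousOn (hΩ : IsOpen Ω) {g h : Eu N → ℝ} (hg : ContinuousOn g Ω)
    (hh : Continuous h) (hc : HasCompactSupport h) (hsub : tsupport h ⊆ Ω) :
    Integrable fun x => g x * h x := by
  have hc' : HasCompactSupport fun x => g x * h x := hc.mul_left
  refine Continuous.integrable_of_hasCompactSupport ?_ hc'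
  refine (hg.mul hh.continuousOn).continuous_of_tsupport_subset hΩ ?_
  exact (closure_mono fun x hx => right_ne_zero_of_mul hx).trans hsub

lemma tsupport_coord_subset (φ : Eu N → Eu N) (i : Fin N) :
    tsupport (fun x => φ x i) ⊆ tsupport φ :=
  closure_mono fun x hx h => hx (by simp [h])

lemma IsTestFunction.coord (hφ : IsTestFunction Ω φ) (i : Fin N) :
    IsTestFunction Ω fun x => φ x i where
  smooth := contDiff_euclidean.1 hφ.smooth i
  compact_supp := hφ.compact_supp.mono' ((subset_tsupport _).trans (tsupport_coord_subset φ i))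
  supp_subset := (tsupport_coord_subset φ i).trans hφ.supp_subset

lemma tsupport_partialDeriv_subset (g : Eu N → ℝ) (i : Fin N) :
    tsupport (partialDeriv i g) ⊆ tsupport g :=
  tsupport_fderiv_apply_subset ℝ _

lemma integrable_mul_partialDeriv (hΩ : IsOpen Ω) {g h : Eu N → ℝ} (hg : ContinuousOn g Ω)
    (hh : IsTestFunction Ω h) (i : Fin N) : Integrable fun x => g x * partialDeriv i h x :=
  integrable_mul_of_continuousOn hΩ hg (continuous_partialDeriv hh.smooth i)
    (hasCompactSupport_partialDeriv hh.compact_supp i)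
    ((tsupport_partialDeriv_subset h i).trans hh.supp_subset)

/-- Integration by parts for `g` smooth on `Ω` only: the support of `φ` lies in `Ω`, so
differentiability elsewhere does not matter. -/
lemma integral_mul_divergence_eq_neg (hΩ : IsOpen Ω) {g : Eu N → ℝ}
    (hg : ∀ x ∈ Ω, ContDiffAt ℝ ∞ g x) (hφ : IsTestFunction Ω φ) :
    ∫ x, g x * divergence φ x = -∫ x, fderiv ℝ g x (φ x) := by
  have hgc : ContinuousOn g Ω := fun x hx => (hg x hx).continuousAt.continuousWithinAt
  have hgd : ∀ i : Fin N, ContinuousOn (fun x => fderiv ℝ g x (EuclideanSpace.single i 1)) Ω :=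
    fun i x hx => (((hg x hx).fderiv_right (m := ∞) (by simp)).continuousAt.clm_apply
      continuousAt_const).continuousWithinAt
  have hi : ∀ i : Fin N, Integrable fun x => fderiv ℝ g x (EuclideanSpace.single i 1) * φ x i :=
    fun i => integrable_mul_of_continuousOn hΩ (hgd i) (hφ.coord i).smooth.continuous
      (hφ.coord i).compact_supp (hφ.coord i).supp_subset
  have hsum : ∀ x, fderiv ℝ g x (φ x) =
      ∑ i, fderiv ℝ g x (EuclideanSpace.single i 1) * φ x i := fun x =>
    (sum_clm_single_mul _ _).symm
  simp_rw [hsum, divergence, Finset.mul_sum]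
  rw [integral_finsetSum _ fun i _ => integrable_mul_partialDeriv hΩ hgc (hφ.coord i) i,
    integral_finsetSum _ fun i _ => hi i, ← Finset.sum_neg_distrib]
  refine Finset.sum_congr rfl fun i _ => ?_
  exact integral_mul_fderiv_eq_neg_fderiv_mul_of_integrable (hi i)
    (integrable_mul_partialDeriv hΩ hgc (hφ.coord i) i)
    (integrable_mul_of_continuousOn hΩ hgc (hφ.coord i).smooth.continuous
      (hφ.coord i).compact_supp (hφ.coord i).supp_subset)
    (fun x hx => (hg x ((hφ.coord i).supp_subset hx)).differentiableAt (by simp))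
    (fun x _ => (hφ.coord i).smooth.differentiable (by simp) x)

/-- The divergence of the adjoint field is the adjoint average of the divergence. -/
theorem divergence_adjointField_eq (hΩ : IsOpen Ω) (hρ : IsBump ρ) (hs : IsRadius Ω L s)
    (hφ : IsTestFunction Ω φ) (y : Eu N) :
    divergence (adjointField ρ s φ) y = ∫ x in Ω, avgKernel ρ s x y * divergence φ x := by
  rw [divergence_adjointField hΩ hρ hs hφ, ← integral_mul_divergence_eq_neg hΩ
    (fun x hx => hρ.contDiffAt_avgKernel_left hΩ hs hx y) hφ,
    setIntegral_eq_integral_of_forall_compl_eq_zero]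
  intro x hx
  have : ∀ i : Fin N, partialDeriv i (fun y => φ y i) x = 0 := fun i =>
    image_eq_zero_of_notMem_tsupport fun h => hx ((hφ.coord i).supp_subset
      (tsupport_partialDeriv_subset _ i h))
  simp [divergence, this]

end Kernel

/-! ### Operator bounds in $L^1$ and for the variation -/

section Bounds

variable {N : ℕ} {Ω : Set (Eu N)} {ρ s f : Eu N → ℝ} {L A : ℝ}

/-- The mass `∫ K(x, y) dx` of the averaging kernel is bounded by `A`. -/
def MassBound (Ω : Set (Eu N)) (ρ s : Eu N → ℝ) (A : ℝ) : Prop :=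
  ∀ y ∈ Ω, ∫⁻ x in Ω, ENNReal.ofReal (avgKernel ρ s x y) ≤ ENNReal.ofReal A

lemma continuousOn_avgKernel (hΩ : IsOpen Ω) (hρ : IsBump ρ) (hs : IsRadius Ω L s) :
    ContinuousOn (fun q : Eu N × Eu N => avgKernel ρ s q.1 q.2) (Ω ×ˢ Ω) := by
  intro q hq
  refine ContinuousAt.continuousWithinAt ?_
  exact (hρ.contDiffAt_avgKernel hΩ hs (q := q.swap) hq.1).continuousAt.comp
    (f := Prod.swap) continuous_swap.continuousAt

lemma aestronglyMeasurable_avgKernel (hΩ : IsOpen Ω) (hρ : IsBump ρ) (hs : IsRadius Ω L s) :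
    AEStronglyMeasurable (fun q : Eu N × Eu N => avgKernel ρ s q.1 q.2)
      ((volume.restrict Ω).prod (volume.restrict Ω)) := by
  rw [Measure.prod_restrict]
  exact (continuousOn_avgKernel hΩ hρ hs).aestronglyMeasurable
    (hΩ.measurableSet.prod hΩ.measurableSet)

/-- By Tonelli the integral in $x$ is taken first, where the mass is at most `A`. The normalization
controls only the integral in $y$. -/
lemma lintegral_avgKernel_mul_le (hΩ : IsOpen Ω) (hρ : IsBump ρ) (hs : IsRadius Ω L s)
    (hA : MassBound Ω ρ s A) (hf : IntegrableOn f Ω) :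
    ∫⁻ q, ‖avgKernel ρ s q.1 q.2 * f q.2‖ₑ ∂((volume.restrict Ω).prod (volume.restrict Ω)) ≤
      ENNReal.ofReal A * ∫⁻ y in Ω, ‖f y‖ₑ := by
  have hm : AEStronglyMeasurable (fun q : Eu N × Eu N => avgKernel ρ s q.1 q.2 * f q.2)
      ((volume.restrict Ω).prod (volume.restrict Ω)) :=
    (aestronglyMeasurable_avgKernel hΩ hρ hs).mul hf.aestronglyMeasurable.comp_snd
  rw [lintegral_prod_symm _ hm.enorm, ← lintegral_const_mul' _ _ ENNReal.ofReal_ne_top]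
  refine setLIntegral_mono' hΩ.measurableSet fun y hy => ?_
  simp only [enorm_mul]
  rw [lintegral_mul_const' _ _ enorm_ne_top]
  refine mul_le_mul_left ?_ _
  refine (lintegral_mono_ae ?_).trans (hA y hy)
  filter_upwards [ae_restrict_mem hΩ.measurableSet] with x hx
  rw [Real.enorm_of_nonneg (hρ.avgKernel_nonneg hs hx y)]

lemma integrable_avgKernel_mul (hΩ : IsOpen Ω) (hρ : IsBump ρ) (hs : IsRadius Ω L s)
    (hA : MassBound Ω ρ s A) (hf : IntegrableOn f Ω) :
    Integrable (fun q : Eu N × Eu N => avgKernel ρ s q.1 q.2 * f q.2)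
      ((volume.restrict Ω).prod (volume.restrict Ω)) := by
  refine ⟨(aestronglyMeasurable_avgKernel hΩ hρ hs).mul hf.aestronglyMeasurable.comp_snd, ?_⟩
  refine (lintegral_avgKernel_mul_le hΩ hρ hs hA hf).trans_lt ?_
  exact ENNReal.mul_lt_top ENNReal.ofReal_lt_top hf.2

lemma integrableOn_average (hΩ : IsOpen Ω) (hρ : IsBump ρ) (hs : IsRadius Ω L s)
    (hA : MassBound Ω ρ s A) (hf : IntegrableOn f Ω) : IntegrableOn (average Ω ρ s f) Ω :=
  (integrable_avgKernel_mul hΩ hρ hs hA hf).integral_prod_left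

lemma eLpNorm_average_le (hΩ : IsOpen Ω) (hρ : IsBump ρ) (hs : IsRadius Ω L s)
    (hA : MassBound Ω ρ s A) (hf : IntegrableOn f Ω) :
    eLpNorm (average Ω ρ s f) 1 (volume.restrict Ω) ≤
      ENNReal.ofReal A * eLpNorm f 1 (volume.restrict Ω) := by
  simp only [eLpNorm_one_eq_lintegral_enorm]
  refine le_trans ?_ (lintegral_avgKernel_mul_le hΩ hρ hs hA hf)
  rw [lintegral_prod _ (integrable_avgKernel_mul hΩ hρ hs hA hf).aestronglyMeasurable.enorm]
  exact lintegral_mono fun x => enorm_integral_le_lintegral_enorm _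

variable {φ : Eu N → Eu N}

lemma continuous_divergence {φ : Eu N → Eu N} (hφ : IsTestFunction Ω φ) :
    Continuous (divergence φ) :=
  continuous_finsetSum _ fun i _ => continuous_partialDeriv (hφ.coord i).smooth i

lemma exists_bound_divergence {φ : Eu N → Eu N} (hφ : IsTestFunction Ω φ) :
    ∃ B, ∀ x, ‖divergence φ x‖ ≤ B := by
  have h : ∀ i : Fin N, ∃ B, ∀ x, ‖partialDeriv i (fun y => φ y i) x‖ ≤ B := fun i =>
    (hasCompactSupport_partialDeriv (hφ.coord i).compact_supp i).exists_bound_of_continuous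
      (continuous_partialDeriv (hφ.coord i).smooth i)
  choose B hB using h
  exact ⟨∑ i, B i, fun x => norm_sum_le_of_le _ fun i _ => hB i x⟩

/-- Fubini turns the average of `f` into the adjoint average of `div φ`, which is a divergence. -/
lemma integral_average_mul_divergence (hΩ : IsOpen Ω) (hρ : IsBump ρ) (hs : IsRadius Ω L s)
    (hA : MassBound Ω ρ s A) (hf : IntegrableOn f Ω) (hφ : IsTestFunction Ω φ) :
    ∫ x in Ω, average Ω ρ s f x * divergence φ x =
      ∫ y in Ω, f y * divergence (adjointField ρ s φ) y := by
  obtain ⟨B, hB⟩ := exists_bound_divergence hφ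
  have hint : Integrable (fun q : Eu N × Eu N =>
      avgKernel ρ s q.1 q.2 * f q.2 * divergence φ q.1)
      ((volume.restrict Ω).prod (volume.restrict Ω)) :=
    (integrable_avgKernel_mul hΩ hρ hs hA hf).mul_bdd
      ((continuous_divergence hφ).comp continuous_fst).aestronglyMeasurable
      (ae_of_all _ fun q => hB q.1)
  simp_rw [divergence_adjointField_eq hΩ hρ hs hφ, average, ← integral_const_mul,
    ← integral_mul_const]
  rw [integral_integral_swap hint]
  congr 1; ext y
  congr 1; ext x
  ring

/-- Where the kernel is nonzero, $|r|<1$, so the correction term has norm at most `L`. -/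
lemma norm_fieldKernel_le (hρ : IsBump ρ) (hs : IsRadius Ω L s)
    (h1 : ∀ x, ‖φ x‖ ≤ 1) {x : Eu N} (hx : x ∈ Ω) (y : Eu N) :
    ‖fieldKernel ρ s φ (y, x)‖ ≤ avgKernel ρ s x y * (1 + L) := by
  have hpos := hs.pos x hx
  rcases le_or_gt (s x) ‖x - y‖ with h | h
  · simp [fieldKernel, hρ.avgKernel_eq_zero hpos h]
  · have hr : ‖(s x)⁻¹ • (x - y)‖ ≤ 1 := by
      rw [norm_smul, norm_inv, Real.norm_of_nonneg hpos.le, inv_mul_le_iff₀ hpos]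
      simpa using h.le
    have hL : ‖fderiv ℝ s x (φ x)‖ ≤ L := by
      refine (ContinuousLinearMap.le_opNorm _ _).trans ?_
      have := hs.grad_bounded x hx
      nlinarith [h1 x, norm_nonneg (φ x), norm_nonneg (fderiv ℝ s x)]
    rw [fieldKernel, norm_smul, Real.norm_of_nonneg (hρ.avgKernel_nonneg hs hx y)]
    refine mul_le_mul_of_nonneg_left ?_ (hρ.avgKernel_nonneg hs hx y)
    refine (norm_sub_le _ _).trans (add_le_add (h1 x) ?_)
    rw [norm_smul]
    nlinarith [norm_nonneg (fderiv ℝ s x (φ x)), norm_nonneg ((s x)⁻¹ • (x - y))]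

lemma norm_adjointField_le (hΩ : IsOpen Ω) (hρ : IsBump ρ) (hs : IsRadius Ω L s) (hL : 0 ≤ L)
    (hA0 : 0 ≤ A) (hA : MassBound Ω ρ s A) (hφ : IsTestFunction Ω φ) (h1 : ∀ x, ‖φ x‖ ≤ 1)
    (y : Eu N) : ‖adjointField ρ s φ y‖ ≤ A * (1 + L) := by
  by_cases hy : y ∈ Ω
  · have hset : adjointField ρ s φ y = ∫ x in Ω, fieldKernel ρ s φ (y, x) := by
      refine (setIntegral_eq_integral_of_forall_compl_eq_zero fun x hx => ?_).symm
      exact fieldKernel_eq_zero hρ hs hφ fun h => hx (mem_of_mem_fieldSupport hs hφ h).2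
    have h2 : ‖adjointField ρ s φ y‖ₑ ≤ ENNReal.ofReal (A * (1 + L)) := by
      rw [hset]
      refine (enorm_integral_le_lintegral_enorm _).trans ?_
      rw [ENNReal.ofReal_mul hA0]
      calc ∫⁻ x in Ω, ‖fieldKernel ρ s φ (y, x)‖ₑ
          ≤ ∫⁻ x in Ω, ENNReal.ofReal (avgKernel ρ s x y) * ENNReal.ofReal (1 + L) := by
            refine setLIntegral_mono' hΩ.measurableSet fun x hx => ?_
            rw [← ENNReal.ofReal_mul (hρ.avgKernel_nonneg hs hx y), ← ofReal_norm]
            exact ENNReal.ofReal_le_ofReal (norm_fieldKernel_le hρ hs h1 hx y)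
        _ ≤ _ := by
            rw [lintegral_mul_const' _ _ ENNReal.ofReal_ne_top]
            exact mul_le_mul_left (hA y hy) _
    rw [← ofReal_norm] at h2
    exact (ENNReal.ofReal_le_ofReal_iff (by positivity)).1 h2
  · rw [image_eq_zero_of_notMem_tsupport fun h =>
      hy ((isTestFunction_adjointField hΩ hρ hs hφ).supp_subset h), norm_zero]
    positivity

/-- Averaging increases the total variation at most by the factor `A (1 + L)`. -/
theorem totalVariation_average_le (hΩ : IsOpen Ω) (hρ : IsBump ρ) (hs : IsRadius Ω L s)
    (hL : 0 ≤ L) (hA0 : 0 ≤ A) (hA : MassBound Ω ρ s A) (hf : IsBV Ω f) :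
    totalVariation Ω (average Ω ρ s f) ≤ ENNReal.ofReal (A * (1 + L)) * totalVariation Ω f := by
  refine iSup_le fun φ => iSup_le fun hφ => iSup_le fun h1 => ?_
  rw [integral_average_mul_divergence hΩ hρ hs hA hf.1 hφ]
  have h := integral_mul_divergence_le hf.2 (isTestFunction_adjointField hΩ hρ hs hφ)
    (C := A * (1 + L)) (by positivity) (norm_adjointField_le hΩ hρ hs hL hA0 hA hφ h1)
  refine (ENNReal.ofReal_le_ofReal h).trans ?_
  rw [ENNReal.ofReal_mul ENNReal.toReal_nonneg, ENNReal.ofReal_toReal hf.2.ne, mul_comm]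

theorem isBV_average (hΩ : IsOpen Ω) (hρ : IsBump ρ) (hs : IsRadius Ω L s)
    (hL : 0 ≤ L) (hA0 : 0 ≤ A) (hA : MassBound Ω ρ s A) (hf : IsBV Ω f) :
    IsBV Ω (average Ω ρ s f) :=
  ⟨integrableOn_average hΩ hρ hs hA hf.1, (totalVariation_average_le hΩ hρ hs hL hA0 hA hf).trans_lt
    (ENNReal.mul_lt_top ENNReal.ofReal_lt_top hf.2)⟩

end Bounds

/-! ### Bounds for the mass of the kernel in its first variable -/

section MassBounds

variable {N : ℕ} {Ω : Set (Eu N)} {ρ s : Eu N → ℝ} {L : ℝ}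

/-- Mean value inequality on the ball around `x` of radius `s x`, which is convex and lies in `Ω`;
`Ω` itself need not be convex. -/
lemma IsRadius.abs_sub_le (hΩ : IsOpen Ω) (hs : IsRadius Ω L s) {x y : Eu N} (hx : x ∈ Ω)
    (h : ‖x - y‖ ≤ s x) : |s x - s y| ≤ L * ‖x - y‖ := by
  have hsub := hs.closedBall_subset x hx
  have hy : y ∈ Metric.closedBall x (s x) := by rwa [Metric.mem_closedBall', dist_eq_norm]
  exact (convex_closedBall x (s x)).norm_image_sub_le_of_norm_fderiv_le
    (fun z hz => (hs.smooth.contDiffAt (hΩ.mem_nhds (hsub hz))).differentiableAt (by simp))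
    (fun z hz => hs.grad_bounded z (hsub hz)) hy (Metric.mem_closedBall_self (hs.pos x hx).le)

lemma IsBump.avgKernel_le (hρ : IsBump ρ) {x y : Eu N} (hx : 0 < s x) {B : ℝ}
    (hB : (s x)⁻¹ ≤ B) : avgKernel ρ s x y ≤ (∫ z, ρ z)⁻¹ * B ^ N := by
  have h0 := hρ.integral_pos
  rw [avgKernel]
  refine mul_le_mul_of_nonneg_left ?_ (by positivity)
  refine (mul_le_of_le_one_right (by positivity) (hρ.le_one _)).trans ?_
  exact pow_le_pow_left₀ (by positivity) hB N

lemma lintegral_indicator_ball (y : Eu N) {r : ℝ} (hr : 0 < r) (c : ENNReal) :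
    ∫⁻ x, (Metric.ball y r).indicator (fun _ => c) x =
      c * ENNReal.ofReal (r ^ N * (volume (Metric.ball (0 : Eu N) 1)).toReal) := by
  rw [lintegral_indicator measurableSet_ball, setLIntegral_const, Measure.addHaar_ball_of_pos _ _ hr,
    ENNReal.ofReal_mul (by positivity), ENNReal.ofReal_toReal measure_ball_lt_top.ne,
    finrank_euclideanSpace, Fintype.card_fin]

/-- For a radius with small gradient the mass is bounded in terms of the kernel and of the gradient
bound only. -/
lemma massBound_of_lt_one (hΩ : IsOpen Ω) (hρ : IsBump ρ) (hs : IsRadius Ω L s) (hL : 0 ≤ L)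
    (hL1 : L < 1) : MassBound Ω ρ s
      ((∫ z, ρ z)⁻¹ * ((1 + L) / (1 - L)) ^ N * (volume (Metric.ball (0 : Eu N) 1)).toReal) := by
  intro y hy
  have hsy := hs.pos y hy
  have h0 := hρ.integral_pos
  have hL' : 0 < 1 - L := by linarith
  -- If $|x-y|<s(x)$, then $s(x)\le s(y)+L|x-y|$ gives $(1-L)|x-y|<s(y)$, and $s(y)\le(1+L)s(x)$
  -- bounds $s(x)^{-N}$. The powers of $s(y)$ cancel after integration over the ball.
  have hpt : ∀ x ∈ Ω, ENNReal.ofReal (avgKernel ρ s x y) ≤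
      (Metric.ball y (s y / (1 - L))).indicator
        (fun _ => ENNReal.ofReal ((∫ z, ρ z)⁻¹ * ((1 + L) / s y) ^ N)) x := by
    intro x hx
    have hsx := hs.pos x hx
    rcases le_or_gt (s x) ‖x - y‖ with h | h
    · simp [hρ.avgKernel_eq_zero hsx h]
    · have hd := abs_le.1 (hs.abs_sub_le hΩ hx h.le)
      have hb : x ∈ Metric.ball y (s y / (1 - L)) := by
        rw [Metric.mem_ball, dist_eq_norm, lt_div_iff₀ hL']
        nlinarith
      rw [Set.indicator_of_mem hb]
      refine ENNReal.ofReal_le_ofReal (hρ.avgKernel_le hsx ?_)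
      rw [inv_le_comm₀ hsx (by positivity), inv_div, div_le_iff₀ (by positivity)]
      nlinarith
  refine (setLIntegral_mono' hΩ.measurableSet hpt).trans ?_
  refine (setLIntegral_le_lintegral _ _).trans ?_
  rw [lintegral_indicator_ball _ (by positivity), ← ENNReal.ofReal_mul (by positivity)]
  refine ENNReal.ofReal_le_ofReal (le_of_eq ?_)
  rw [div_pow, div_pow, div_pow]
  field_simp

/-- A radius comparable to the squared boundary distance gives a bounded mass. -/
lemma exists_massBound (hΩ : IsOpen Ω) (hΩb : Bornology.IsBounded Ω) (hρ : IsBump ρ)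
    (hs : IsRadius Ω L s) {κ : ℝ} (hκ : 0 < κ) (hd : ∀ x ∈ Ω, 0 < bdryDist Ω x)
    (hlow : ∀ x ∈ Ω, κ * bdryDist Ω x ^ 2 ≤ s x) (hup : ∀ x ∈ Ω, s x ≤ bdryDist Ω x ^ 2) :
    ∃ A, 0 ≤ A ∧ MassBound Ω ρ s A := by
  have h0 := hρ.integral_pos
  refine ⟨(∫ z, ρ z)⁻¹ * ((9 / κ) ^ N * (volume (Metric.ball (0 : Eu N) 1)).toReal +
    (4 / κ) ^ N * (volume Ω).toReal), by positivity, fun y hy => ?_⟩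
  set σ := bdryDist Ω
  have hσ : ∀ x y, |σ x - σ y| ≤ ‖x - y‖ := fun x y => by
    rw [← dist_eq_norm, ← Real.dist_eq]
    simpa [σ, bdryDist] using (Metric.lipschitz_infDist_pt (frontier Ω)).dist_le_mul x y
  have hσy := hd y hy
  have hpt : ∀ x ∈ Ω, ENNReal.ofReal (avgKernel ρ s x y) ≤
      (Metric.ball y (4 * σ y ^ 2)).indicator
        (fun _ => ENNReal.ofReal ((∫ z, ρ z)⁻¹ * (9 / (4 * κ * σ y ^ 2)) ^ N)) x +
        ENNReal.ofReal ((∫ z, ρ z)⁻¹ * (4 / κ) ^ N) := by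
    intro x hx
    have hsx := hs.pos x hx
    have hσx := hd x hx
    have h1 := hlow x hx
    have h2 := hup x hx
    rcases le_or_gt (s x) ‖x - y‖ with h | h
    · simp [hρ.avgKernel_eq_zero hsx h]
    · have h3 := abs_le.1 (hσ x y)
      -- For $\sigma(x)\le\frac12$, $|x-y|<\sigma(x)^2\le\sigma(x)/2$ makes $\sigma(x)$ and
      -- $\sigma(y)$ comparable: $s(x)\le4\sigma(y)^2$ and $s(x)\ge\frac49\kappa\sigma(y)^2$. For
      -- $\sigma(x)>\frac12$, $s(x)\ge\kappa/4$ bounds the kernel by a constant on the bounded set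
      -- `Ω`.
      rcases le_or_gt (σ x) (1 / 2) with h4 | h4
      · have h5 : σ x ≤ 2 * σ y := by nlinarith
        have h6 : 2 * σ y ≤ 3 * σ x := by nlinarith
        have hb : x ∈ Metric.ball y (4 * σ y ^ 2) := by
          rw [Metric.mem_ball, dist_eq_norm]
          nlinarith
        rw [Set.indicator_of_mem hb]
        refine le_add_right (ENNReal.ofReal_le_ofReal (hρ.avgKernel_le hsx ?_))
        rw [inv_le_comm₀ hsx (by positivity), inv_div, div_le_iff₀ (by positivity)]
        have : (2 * σ y) ^ 2 ≤ (3 * σ x) ^ 2 := pow_le_pow_left₀ (by positivity) h6 2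
        nlinarith
      · refine le_add_left (ENNReal.ofReal_le_ofReal (hρ.avgKernel_le hsx ?_))
        rw [inv_le_comm₀ hsx (by positivity), inv_div]
        have : (1 / 2) ^ 2 ≤ σ x ^ 2 := pow_le_pow_left₀ (by norm_num) h4.le 2
        nlinarith
  refine (setLIntegral_mono' hΩ.measurableSet hpt).trans ?_
  rw [lintegral_add_right _ measurable_const, setLIntegral_const, mul_add,
    ENNReal.ofReal_add (by positivity) (by positivity)]
  refine add_le_add ?_ ?_
  · refine (setLIntegral_le_lintegral _ _).trans ?_
    rw [lintegral_indicator_ball _ (by positivity), ← ENNReal.ofReal_mul (by positivity)]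
    refine ENNReal.ofReal_le_ofReal (le_of_eq ?_)
    rw [mul_assoc, ← mul_assoc ((9 / (4 * κ * σ y ^ 2)) ^ N), ← mul_pow]
    have h : 9 / (4 * κ * σ y ^ 2) * (4 * σ y ^ 2) = 9 / κ := by
      rw [div_mul_eq_mul_div, div_eq_div_iff (by positivity) (by positivity)]
      ring
    rw [h]
  · rw [← mul_assoc, ENNReal.ofReal_mul (p := _ * _) (by positivity),
      ENNReal.ofReal_toReal hΩb.measure_lt_top.ne]

end MassBounds

/-! ### Lower semicontinuity and criteria for strict and weak* convergence -/

section Convergence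

variable {N : ℕ} {Ω : Set (Eu N)} {u : ℕ → Eu N → ℝ} {v w : Eu N → ℝ}

lemma totalVariation_congr (hΩ : MeasurableSet Ω) (h : Set.EqOn v w Ω) :
    totalVariation Ω v = totalVariation Ω w := by
  unfold totalVariation
  have : ∀ φ : Eu N → Eu N, ∫ x in Ω, v x * divergence φ x = ∫ x in Ω, w x * divergence φ x :=
    fun φ => setIntegral_congr_fun hΩ fun x hx => congrArg (· * divergence φ x) (h hx)
  simp only [this]

lemma IsBV.congr (hΩ : MeasurableSet Ω) (h : Set.EqOn v w Ω) (hv : IsBV Ω v) : IsBV Ω w :=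
  ⟨hv.1.congr_fun h hΩ, totalVariation_congr hΩ h ▸ hv.2⟩

lemma TendstoL1.congr (hΩ : MeasurableSet Ω) {u' : ℕ → Eu N → ℝ}
    (h : ∀ k, Set.EqOn (u k) (u' k) Ω) (hu : TendstoL1 Ω u v) : TendstoL1 Ω u' v := by
  refine Tendsto.congr (fun k => eLpNorm_congr_ae ?_) hu
  filter_upwards [ae_restrict_mem hΩ] with x hx
  rw [h k hx]

lemma TendstoL1.tendsto_integral_mul (hu : ∀ k, IntegrableOn (u k) Ω) (hv : IntegrableOn v Ω)
    (h : TendstoL1 Ω u v) {g : Eu N → ℝ} (hg : Continuous g) {B : ℝ} (hB : ∀ x, ‖g x‖ ≤ B) :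
    Tendsto (fun k => ∫ x in Ω, u k x * g x) atTop (𝓝 (∫ x in Ω, v x * g x)) := by
  refine tendsto_integral_of_L1 _
    (hv.mul_bdd hg.aestronglyMeasurable (ae_of_all _ hB)).aestronglyMeasurable
    (.of_forall fun k => (hu k).mul_bdd hg.aestronglyMeasurable (ae_of_all _ hB)) ?_
  have h2 : Tendsto (fun k => eLpNorm (fun x => u k x - v x) 1 (volume.restrict Ω) *
      ENNReal.ofReal B) atTop (𝓝 0) := by
    simpa using ENNReal.Tendsto.mul_const h (Or.inr ENNReal.ofReal_ne_top) (b := ENNReal.ofReal B)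
  refine tendsto_of_tendsto_of_tendsto_of_le_of_le tendsto_const_nhds h2 (fun k => zero_le)
    fun k => ?_
  simp only [eLpNorm_one_eq_lintegral_enorm]
  rw [← lintegral_mul_const' _ _ ENNReal.ofReal_ne_top]
  refine lintegral_mono fun x => ?_
  rw [← sub_mul, enorm_mul]
  gcongr
  rw [← ofReal_norm]
  exact ENNReal.ofReal_le_ofReal (hB x)

/-- Lower semicontinuity of the total variation. -/
theorem TendstoL1.totalVariation_le_liminf (hu : ∀ k, IntegrableOn (u k) Ω)
    (hv : IntegrableOn v Ω) (h : TendstoL1 Ω u v) :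
    totalVariation Ω v ≤ liminf (fun k => totalVariation Ω (u k)) atTop := by
  refine iSup_le fun φ => iSup_le fun hφ => iSup_le fun h1 => ?_
  obtain ⟨B, hB⟩ := exists_bound_divergence hφ
  have ht := (ENNReal.continuous_ofReal.tendsto _).comp
    (h.tendsto_integral_mul hu hv (continuous_divergence hφ) hB)
  rw [← ht.liminf_eq]
  exact liminf_le_liminf (.of_forall fun k => ofReal_integral_le_totalVariation hφ h1)

/-- Lower semicontinuity bounds the lower limit from below, and `c k → 1` bounds the upper limit
from above. -/
theorem TendstoL1.tendstoStrictBV (hu : ∀ k, IsBV Ω (u k)) (hv : IsBV Ω v) (h : TendstoL1 Ω u v)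
    {c : ℕ → ℝ} (hc : Tendsto c atTop (𝓝 1))
    (hle : ∀ᶠ k in atTop, totalVariation Ω (u k) ≤ ENNReal.ofReal (c k) * totalVariation Ω v) :
    TendstoStrictBV Ω u v := by
  refine ⟨hu, hv, h, tendsto_of_le_liminf_of_limsup_le
    (h.totalVariation_le_liminf (fun k => (hu k).1) hv.1) ?_⟩
  have ht : Tendsto (fun k => ENNReal.ofReal (c k) * totalVariation Ω v) atTop
      (𝓝 (totalVariation Ω v)) := by
    simpa using ENNReal.Tendsto.mul_const ((ENNReal.continuous_ofReal.tendsto _).comp hc)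
      (Or.inr hv.2.ne) (b := totalVariation Ω v)
  exact (limsup_le_limsup hle).trans ht.limsup_eq.le

/-- Continuous functions vanishing outside `Ω` and at infinity are uniform limits of test
functions. -/
lemma exists_isTestFunction_abs_sub_le (φ : C₀(Eu N, ℝ)) (hφ : ∀ x ∉ Ω, φ x = 0) {ε : ℝ}
    (hε : 0 < ε) : ∃ ψ : Eu N → ℝ, IsTestFunction Ω ψ ∧ ∀ x, |φ x - ψ x| ≤ ε := by
  -- Convex constraints are glued by a smooth partition of unity from the local constants `φ x` or
  -- `0`. The second constraint forces the approximant to vanish where $|\varphi|<\varepsilon/2$;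
  -- the remaining set is compact and lies in `Ω`.
  let t : Eu N → Set ℝ := fun x => {r | |φ x - r| ≤ ε ∧ (|φ x| < ε / 2 → r = 0)}
  have ht : ∀ x, Convex ℝ (t x) := by
    intro x a ha b hb p q hp hq hpq
    refine ⟨?_, fun h => by simp [ha.2 h, hb.2 h]⟩
    have h1 := abs_le.1 ha.1
    have h2 := abs_le.1 hb.1
    have e : φ x - (p • a + q • b) = p * (φ x - a) + q * (φ x - b) := by
      simp only [smul_eq_mul]
      linear_combination (-φ x) * hpq
    rw [e, abs_le]
    constructor <;> nlinarith
  obtain ⟨g, hg⟩ := exists_contMDiffMap_forall_mem_convex_of_local_const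
    (modelWithCornersSelf ℝ (Eu N)) (n := ⊤) ht (by
      intro x
      rcases lt_or_ge (ε / 2) |φ x| with h | h
      · refine ⟨φ x, ?_⟩
        filter_upwards [φ.continuous.abs.continuousAt.eventually (lt_mem_nhds h),
          φ.continuous.continuousAt.eventually (Metric.closedBall_mem_nhds _ hε)] with y h1 h2
        exact ⟨h2, fun h3 => absurd h3 (not_lt.2 (le_of_lt h1))⟩
      · refine ⟨0, ?_⟩
        have h' : |φ x| < ε := by linarith
        filter_upwards [φ.continuous.abs.continuousAt.eventually (gt_mem_nhds h')] with y h1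
        exact ⟨by simpa using le_of_lt h1, fun _ => rfl⟩)
  have hK : IsClosed {x | ε / 2 ≤ |φ x|} := isClosed_le continuous_const φ.continuous.abs
  have hKc : IsCompact {x | ε / 2 ≤ |φ x|} := by
    have := φ.zero_at_infty'.eventually (Metric.ball_mem_nhds 0 (half_pos hε))
    obtain ⟨K, hK1, hK2⟩ := mem_cocompact.1 this
    refine hK1.of_isClosed_subset hK fun x hx => ?_
    by_contra hxK
    have h2 := hK2 hxK
    rw [Set.mem_ofPred_eq, dist_zero_right, Real.norm_eq_abs] at h2
    exact absurd h2 (not_lt.2 hx)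
  have h0 : ∀ x ∉ {x | ε / 2 ≤ |φ x|}, g x = 0 := fun x hx => (hg x).2 (not_le.1 hx)
  refine ⟨g, ⟨g.contMDiff.contDiff, HasCompactSupport.intro hKc h0, ?_⟩, fun x => (hg x).1⟩
  refine (closure_minimal (t := {x | ε / 2 ≤ |φ x|}) (fun x hx => ?_) hK).trans fun x hx => ?_
  · by_contra h
    exact hx (h0 x h)
  · by_contra h
    have h2 : ε / 2 ≤ |φ x| := hx
    rw [hφ x h, abs_zero] at h2
    linarith

/-- A test function as an element of `C₀`. -/
def IsTestFunction.toC₀ {ψ : Eu N → ℝ} (hψ : IsTestFunction Ω ψ) : C₀(Eu N, ℝ) where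
  toFun := ψ
  continuous_toFun := hψ.smooth.continuous
  zero_at_infty' := hψ.compact_supp.is_zero_at_infty

/-- Convergence in `L¹` with bounded variations implies weak* convergence. -/
theorem TendstoL1.tendstoWeakStarBV (hu : ∀ k, IsBV Ω (u k)) (hv : IsBV Ω v)
    (h : TendstoL1 Ω u v) {C : ENNReal} (hC : C ≠ ⊤)
    (hle : ∀ᶠ k in atTop, totalVariation Ω (u k) ≤ C) : TendstoWeakStarBV Ω u v := by
  choose μ hμ hμb using fun k => (hu k).exists_isDerivMeasure
  obtain ⟨ν, hν, hνb⟩ := hv.exists_isDerivMeasure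
  refine ⟨hu, hv, h, μ, ν, hμ, hν, fun i φ hφ => ?_⟩
  rw [Metric.tendsto_atTop']
  intro ε hε
  -- The summand 1 keeps `D` positive. With tolerance `ε / (8 * D)` the two replacements of `φ` by
  -- `ψ` cost `ε / 4` each, as does the convergence tested with `ψ`.
  set D := C.toReal + (totalVariation Ω v).toReal + 1 with hD
  have hD0 : 0 < D := by positivity
  have hδ : 0 < ε / (8 * D) := by positivity
  obtain ⟨ψ, hψ, hφψ⟩ := exists_isTestFunction_abs_sub_le φ hφ hδ
  obtain ⟨B, hB⟩ := (hasCompactSupport_partialDeriv hψ.compact_supp i).exists_bound_of_continuous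
    (continuous_partialDeriv hψ.smooth i)
  have ht := h.tendsto_integral_mul (fun k => (hu k).1) hv.1 (continuous_partialDeriv hψ.smooth i) hB
  simp_rw [(hμ _).integral_by_parts i ψ hψ, hν.integral_by_parts i ψ hψ] at ht
  have ht2 := ht.neg
  simp only [neg_neg] at ht2
  obtain ⟨k₀, hk₀⟩ := eventually_atTop.1 (hle.and (Metric.tendsto_nhds.1 ht2 (ε / 4) (by positivity)))
  refine ⟨k₀, fun k hk => ?_⟩
  obtain ⟨h1, h2⟩ := hk₀ k hk.le
  have h3 := hμb k i φ hψ.toC₀ _ hφψ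
  have h4 := hνb i φ hψ.toC₀ _ hφψ
  change |_ - ∫ᵛ x, ψ x ∂•μ k i| ≤ _ at h3
  change |_ - ∫ᵛ x, ψ x ∂•ν i| ≤ _ at h4
  have h5 : (totalVariation Ω (u k)).toReal ≤ D := by
    have := ENNReal.toReal_mono hC h1
    have := ENNReal.toReal_nonneg (a := totalVariation Ω v)
    linarith
  have h6 : (totalVariation Ω v).toReal ≤ D := by
    have := ENNReal.toReal_nonneg (a := C)
    linarith
  have h7 : 2 * D * (ε / (8 * D)) = ε / 4 := by field_simp; norm_num
  have h8 : 2 * (totalVariation Ω (u k)).toReal * (ε / (8 * D)) ≤ ε / 4 := by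
    rw [← h7]; gcongr
  have h9 : 2 * (totalVariation Ω v).toReal * (ε / (8 * D)) ≤ ε / 4 := by
    rw [← h7]; gcongr
  rw [Real.dist_eq, abs_lt] at h2 ⊢
  have h3' := abs_le.1 h3
  have h4' := abs_le.1 h4
  constructor <;> linarith [h2.1, h2.2, h3'.1, h3'.2, h4'.1, h4'.2]

end Convergence

/-! ### Change of variables and $L^1$ convergence of averages -/

section Averages

variable {N : ℕ} {Ω : Set (Eu N)} {ρ s f : Eu N → ℝ} {L A : ℝ}

/-- Substitution $y=x-s(x)z$. The integrand lives on the ball of radius $s(x)$ around $x$, which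
lies in `Ω`. -/
lemma integral_scaled_mul (hρ : IsBump ρ) (hs : IsRadius Ω L s) {x : Eu N} (hx : x ∈ Ω)
    (g : Eu N → ℝ) : ∫ y in Ω, ρ ((s x)⁻¹ • (x - y)) * g y =
      s x ^ N * ∫ z in Metric.ball (0 : Eu N) 1, ρ z * g (x - s x • z) := by
  have hpos := hs.pos x hx
  rw [setIntegral_eq_integral_of_forall_compl_eq_zero (s := Ω),
    setIntegral_eq_integral_of_forall_compl_eq_zero (s := Metric.ball (0 : Eu N) 1)]
  · have h1 := integral_sub_left_eq_self
      (fun y => ρ ((s x)⁻¹ • y) * g (x - s x • ((s x)⁻¹ • y))) volume x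
    have h2 := Measure.integral_comp_inv_smul_of_nonneg volume
      (fun z => ρ z * g (x - s x • z)) hpos.le
    rw [h2, finrank_euclideanSpace, Fintype.card_fin] at h1
    simpa [smul_smul, hpos.ne'] using h1
  · intro z hz
    rw [hρ.eq_zero z (by simpa using hz), zero_mul]
  · intro y hy
    rw [hρ.eq_zero, zero_mul]
    rw [norm_smul, norm_inv, Real.norm_of_nonneg hpos.le, le_inv_mul_iff₀ hpos, mul_one]
    by_contra! h
    exact hy (hs.closedBall_subset x hx (by
      rw [Metric.mem_closedBall', dist_eq_norm]; exact h.le))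

lemma IsBump.setIntegral_ball (hρ : IsBump ρ) :
    ∫ z in Metric.ball (0 : Eu N) 1, ρ z = ∫ z, ρ z :=
  setIntegral_eq_integral_of_forall_compl_eq_zero fun z hz => hρ.eq_zero z (by simpa using hz)

lemma average_eq (hρ : IsBump ρ) (hs : IsRadius Ω L s) {x : Eu N} (hx : x ∈ Ω) (g : Eu N → ℝ) :
    average Ω ρ s g x =
      (∫ z, ρ z)⁻¹ * ∫ z in Metric.ball (0 : Eu N) 1, ρ z * g (x - s x • z) := by
  have hpos := hs.pos x hx
  simp only [average, avgKernel, mul_assoc]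
  rw [integral_const_mul, integral_const_mul, integral_scaled_mul hρ hs hx, ← mul_assoc (_ ^ N),
    ← mul_pow, inv_mul_cancel₀ hpos.ne', one_pow, one_mul]

lemma average_one (hρ : IsBump ρ) (hs : IsRadius Ω L s) {x : Eu N} (hx : x ∈ Ω) :
    ∫ y in Ω, avgKernel ρ s x y = 1 := by
  have h := average_eq hρ hs hx fun _ => 1
  simp only [average, mul_one] at h
  rw [h, hρ.setIntegral_ball, inv_mul_cancel₀ hρ.integral_pos.ne']

lemma abs_average_sub_le (hρ : IsBump ρ) (hs : IsRadius Ω L s) {x : Eu N}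
    (hx : x ∈ Ω) {g : Eu N → ℝ} (hg : Continuous g) {B : ℝ} (hB : ∀ y, ‖g y‖ ≤ B) {ε : ℝ}
    (hε : ∀ y, ‖x - y‖ < s x → |g y - g x| ≤ ε) : |average Ω ρ s g x - g x| ≤ ε := by
  have h1 := average_one hρ hs hx
  -- A nonintegrable function has Bochner integral 0, so an integral equal to 1 proves
  -- integrability.
  have hint : Integrable (avgKernel ρ s x) (volume.restrict Ω) :=
    integrable_of_integral_eq_one h1
  have hintg : Integrable (fun y => avgKernel ρ s x y * g y) (volume.restrict Ω) :=
    hint.mul_bdd hg.aestronglyMeasurable (ae_of_all _ hB)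
  have h2 : average Ω ρ s g x - g x = ∫ y in Ω, avgKernel ρ s x y * (g y - g x) := by
    simp_rw [mul_sub]
    rw [integral_sub hintg (hint.mul_const _), integral_mul_const, h1, one_mul]
    rfl
  have h3 : ∀ y, ‖avgKernel ρ s x y * (g y - g x)‖ ≤ avgKernel ρ s x y * ε := by
    intro y
    rw [norm_mul, Real.norm_of_nonneg (hρ.avgKernel_nonneg hs hx y)]
    rcases le_or_gt (s x) ‖x - y‖ with h | h
    · simp [hρ.avgKernel_eq_zero (hs.pos x hx) h]
    · exact mul_le_mul_of_nonneg_left (hε y h) (hρ.avgKernel_nonneg hs hx y)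
  rw [h2]
  refine (norm_integral_le_of_norm_le (hint.mul_const ε) (ae_of_all _ h3)).trans ?_
  rw [integral_mul_const, h1, one_mul]

lemma average_sub_ae (hΩ : IsOpen Ω) (hρ : IsBump ρ) (hs : IsRadius Ω L s)
    (hA : MassBound Ω ρ s A) {g : Eu N → ℝ} (hf : IntegrableOn f Ω) (hg : IntegrableOn g Ω) :
    average Ω ρ s (f - g) =ᵐ[volume.restrict Ω] average Ω ρ s f - average Ω ρ s g := by
  filter_upwards [(integrable_avgKernel_mul hΩ hρ hs hA hf).prod_right_ae,
    (integrable_avgKernel_mul hΩ hρ hs hA hg).prod_right_ae] with x h1 h2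
  simp only [average, Pi.sub_apply, mul_sub]
  exact integral_sub h1 h2

/-- Averages over balls with radii tending uniformly to zero converge in `L¹`. -/
theorem tendstoL1_average (hΩ : IsOpen Ω) (hΩb : Bornology.IsBounded Ω) (hf : IntegrableOn f Ω)
    {ρ s : ℕ → Eu N → ℝ} {L δ : ℕ → ℝ} (hρ : ∀ k, IsBump (ρ k)) (hs : ∀ k, IsRadius Ω (L k) (s k))
    {A : ℝ} (hA : ∀ᶠ k in atTop, MassBound Ω (ρ k) (s k) A) (hδ : Tendsto δ atTop (𝓝 0))
    (hsδ : ∀ k, ∀ x ∈ Ω, s k x ≤ δ k) :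
    TendstoL1 Ω (fun k => average Ω (ρ k) (s k) f) f := by
  rw [TendstoL1, ENNReal.tendsto_nhds_zero]
  intro ε hε
  by_cases hεt : ε = ⊤
  · simp [hεt]
  have hc : ENNReal.ofReal A + 1 + volume Ω ≠ ⊤ := by
    simp [hΩb.measure_lt_top.ne]
  -- The tolerance is fitted to the splitting $Tf-f=T(f-g)+(Tg-g)+(g-f)$ with $g\in C_c$, whose
  -- terms are at most $A\eta$, $\eta|\Omega|$ and $\eta$.
  obtain ⟨η, hη, hηε⟩ : ∃ η : ℝ, 0 < η ∧
      ENNReal.ofReal η * (ENNReal.ofReal A + 1 + volume Ω) ≤ ε := by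
    have h1 : 0 < (ENNReal.ofReal A + 1 + volume Ω).toReal :=
      ENNReal.toReal_pos (by simp) hc
    refine ⟨ε.toReal / (ENNReal.ofReal A + 1 + volume Ω).toReal,
      div_pos (ENNReal.toReal_pos hε.ne' hεt) h1, ?_⟩
    rw [ENNReal.ofReal_div_of_pos h1, ENNReal.ofReal_toReal hεt, ENNReal.ofReal_toReal hc]
    rw [ENNReal.div_mul_cancel (by simp) hc]
  have hfi : MemLp (Ω.indicator f) 1 volume :=
    memLp_one_iff_integrable.2 ((integrable_indicator_iff hΩ.measurableSet).2 hf)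
  obtain ⟨g, hgc, hgf, hg, hgi⟩ := hfi.exists_hasCompactSupport_eLpNorm_sub_le ENNReal.one_ne_top
    (ε := ENNReal.ofReal η) (by simpa using hη)
  obtain ⟨B, hB⟩ := hgc.exists_bound_of_continuous hg
  have hgΩ : IntegrableOn g Ω := (memLp_one_iff_integrable.1 hgi).integrableOn
  have hfg : eLpNorm (f - g) 1 (volume.restrict Ω) ≤ ENNReal.ofReal η := by
    refine le_trans (le_of_eq (eLpNorm_congr_ae ?_)) ((eLpNorm_mono_measure (Ω.indicator f - g)
      (Measure.restrict_le_self (s := Ω))).trans hgf)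
    filter_upwards [ae_restrict_mem hΩ.measurableSet] with x hx
    simp [hx]
  obtain ⟨r, hr, hru⟩ := Metric.uniformContinuous_iff.1
    (hgc.uniformContinuous_of_continuous hg) η hη
  filter_upwards [hA, hδ.eventually (gt_mem_nhds hr)] with k hAk hδk
  have hpt : ∀ x ∈ Ω, |average Ω (ρ k) (s k) g x - g x| ≤ η := fun x hx =>
    abs_average_sub_le (hρ k) (hs k) hx hg hB fun y hy => by
      have := hru (a := y) (b := x) (by
        rw [dist_comm, dist_eq_norm]
        exact hy.trans_le ((hsδ k x hx).trans hδk.le))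
      rw [Real.dist_eq] at this
      exact this.le
  have hTf := integrableOn_average hΩ (hρ k) (hs k) hAk hf
  have hTg := integrableOn_average hΩ (hρ k) (hs k) hAk hgΩ
  have e : (fun x => average Ω (ρ k) (s k) f x - f x) =ᵐ[volume.restrict Ω]
      (average Ω (ρ k) (s k) (f - g) + (average Ω (ρ k) (s k) g - g)) + (g - f) := by
    filter_upwards [average_sub_ae hΩ (hρ k) (hs k) hAk hf hgΩ] with x hx
    simp [hx]
  have hTfg := integrableOn_average hΩ (hρ k) (hs k) hAk (hf.sub hgΩ)
  rw [eLpNorm_congr_ae e]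
  refine (eLpNorm_add_le (hTfg.aestronglyMeasurable.add
    (hTg.aestronglyMeasurable.sub hgΩ.aestronglyMeasurable))
    (hgΩ.aestronglyMeasurable.sub hf.aestronglyMeasurable) le_rfl).trans ?_
  have b1 : eLpNorm (average Ω (ρ k) (s k) (f - g)) 1 (volume.restrict Ω) ≤
      ENNReal.ofReal A * ENNReal.ofReal η :=
    (eLpNorm_average_le hΩ (hρ k) (hs k) hAk (hf.sub hgΩ)).trans (by gcongr)
  have b2 : eLpNorm (average Ω (ρ k) (s k) g - g) 1 (volume.restrict Ω) ≤
      ENNReal.ofReal η * volume Ω := by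
    rw [eLpNorm_one_eq_lintegral_enorm, ← setLIntegral_const]
    refine setLIntegral_mono' hΩ.measurableSet fun x hx => ?_
    rw [← ofReal_norm]
    exact ENNReal.ofReal_le_ofReal (hpt x hx)
  have b3 : eLpNorm (g - f) 1 (volume.restrict Ω) ≤ ENNReal.ofReal η := by
    rwa [eLpNorm_sub_comm]
  refine (add_le_add ((eLpNorm_add_le hTfg.aestronglyMeasurable
    (hTg.aestronglyMeasurable.sub hgΩ.aestronglyMeasurable) le_rfl).trans
    (add_le_add b1 b2)) b3).trans (le_trans (le_of_eq ?_) hηε)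
  ring

end Averages

/-! ### Distance to the boundary and admissible radii -/

section Geometry

variable {N : ℕ} {Ω : Set (Eu N)}

/-- For $N\ge1$ the whole space is unbounded, hence not `Ω`. With an empty frontier `infDist` would
take its default value 0 and `bdryDist` would not be positive. -/
lemma frontier_nonempty (hN : 1 ≤ N) (hΩb : Bornology.IsBounded Ω) (hne : Ω.Nonempty) :
    (frontier Ω).Nonempty := by
  have : Nonempty (Fin N) := ⟨⟨0, hN⟩⟩
  refine nonempty_frontier_iff.2 ⟨hne, fun h => ?_⟩
  rw [h] at hΩb
  exact NormedSpace.unbounded_univ ℝ (Eu N) hΩb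

lemma bdryDist_pos (hN : 1 ≤ N) (hΩ : IsOpen Ω) (hΩb : Bornology.IsBounded Ω) {x : Eu N}
    (hx : x ∈ Ω) : 0 < bdryDist Ω x := by
  refine (isClosed_frontier.notMem_iff_infDist_pos (frontier_nonempty hN hΩb ⟨x, hx⟩)).1 fun h => ?_
  rw [hΩ.frontier_eq] at h
  exact h.2 hx

/-- The ball is connected and misses the boundary, so it cannot meet both `Ω` and the exterior. -/
lemma ball_bdryDist_subset (hN : 1 ≤ N) (hΩ : IsOpen Ω) (hΩb : Bornology.IsBounded Ω) {x : Eu N}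
    (hx : x ∈ Ω) : Metric.ball x (bdryDist Ω x) ⊆ Ω := by
  have hpos := bdryDist_pos hN hΩ hΩb hx
  refine (convex_ball x (bdryDist Ω x)).isPreconnected.subset_left_of_subset_union hΩ
    isClosed_closure.isOpen_compl (Set.disjoint_left.2 fun y hy h => h (subset_closure hy)) ?_
    ⟨x, Metric.mem_ball_self hpos, hx⟩
  intro y hy
  by_contra h
  simp only [Set.mem_union, Set.mem_compl_iff, not_or, not_not] at h
  have hf : y ∈ frontier Ω := by
    rw [hΩ.frontier_eq]
    exact ⟨h.2, h.1⟩
  exact Metric.notMem_of_dist_lt_infDist (Metric.mem_ball'.1 hy) hf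

/-- The distance attains its maximum on the compact closure and vanishes on the boundary, so the
strict bound holds with a gap. The gap gives a positive lower constant common to all modified steps.
-/
lemma exists_bdryDist_le (hΩb : Bornology.IsBounded Ω) {c : ℝ} (hc : 0 < c)
    (h : ∀ x ∈ Ω, bdryDist Ω x < c) : ∃ m, 0 ≤ m ∧ m < c ∧ ∀ x ∈ Ω, bdryDist Ω x ≤ m := by
  rcases Ω.eq_empty_or_nonempty with rfl | hne
  · exact ⟨0, le_rfl, hc, by simp⟩
  · obtain ⟨x₀, hx₀, hmax⟩ := hΩb.isCompact_closure.exists_isMaxOn hne.closure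
      (Metric.continuous_infDist_pt (frontier Ω)).continuousOn
    refine ⟨bdryDist Ω x₀, Metric.infDist_nonneg, ?_, fun x hx => hmax (subset_closure hx)⟩
    by_cases hx : x₀ ∈ Ω
    · exact h _ hx
    · have : x₀ ∈ frontier Ω := ⟨hx₀, fun h => hx (interior_subset h)⟩
      rw [bdryDist, Metric.infDist_zero_of_mem this]
      exact hc

lemma exists_bdryDist_bound (hΩb : Bornology.IsBounded Ω) :
    ∃ D, 0 ≤ D ∧ ∀ x ∈ Ω, bdryDist Ω x ≤ D := by
  obtain ⟨D, hD⟩ := (hΩb.isCompact_closure.image (Metric.continuous_infDist_pt (frontier Ω))).bddAbove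
  exact ⟨max D 0, le_max_right _ _, fun x hx =>
    (hD ⟨x, subset_closure hx, rfl⟩).trans (le_max_left _ _)⟩

lemma isRadius_div (hN : 1 ≤ N) (hΩ : IsOpen Ω) (hΩb : Bornology.IsBounded Ω) {η : Eu N → ℝ}
    {L : ℝ} {n : ℕ} (hn : 1 ≤ n) (hη : ContDiffOn ℝ ∞ η Ω) (hL : ∀ x ∈ Ω, ‖fderiv ℝ η x‖ ≤ L)
    (hpos : ∀ x ∈ Ω, 0 < η x) (hlt : ∀ x ∈ Ω, η x < n * bdryDist Ω x) :
    IsRadius Ω (L / n) (fun x => η x / n) := by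
  have hn0 : (0 : ℝ) < n := by exact_mod_cast hn
  refine ⟨hη.div_const _, fun x hx => ?_, fun x hx => div_pos (hpos x hx) hn0, fun x hx => ?_⟩
  · have hd : DifferentiableAt ℝ η x :=
      (hη.contDiffAt (hΩ.mem_nhds hx)).differentiableAt (by simp)
    simp only [div_eq_mul_inv]
    rw [fderiv_mul_const hd, norm_smul, norm_inv, Real.norm_of_nonneg hn0.le, mul_comm]
    exact mul_le_mul_of_nonneg_right (hL x hx) (by positivity)
  · refine (Metric.closedBall_subset_ball ?_).trans (ball_bdryDist_subset hN hΩ hΩb hx)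
    rw [div_lt_iff₀ hn0, mul_comm]
    exact hlt x hx

end Geometry

/-! ### Both kinds of kernel as bumps, and their integrals -/

section Kernels

variable {N : ℕ} {ρ : Eu N → ℝ}

lemma integral_pos_of_eq_zero_of_one_le (hs : ContDiff ℝ ∞ ρ) (h0 : ∀ x, 0 ≤ ρ x)
    (h1 : ∀ x, 1 ≤ ‖x‖ → ρ x = 0) (h : ρ 0 ≠ 0) : 0 < ∫ x, ρ x := by
  refine hs.continuous.integral_pos_of_hasCompactSupport_nonneg_nonzero ?_ h0 h
  exact HasCompactSupport.intro (isCompact_closedBall 0 1) fun x hx => h1 x (by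
    simp only [mem_closedBall_zero_iff, not_le] at hx
    exact hx.le)

lemma IsKernel.isBump (hρ : IsKernel ρ) : IsBump ρ where
  smooth := hρ.smooth
  nonneg := hρ.nonneg
  le_one := hρ.le_one
  eq_zero x hx := (hρ.eq_zero_iff x).2 hx
  integral_pos := integral_pos_of_eq_zero_of_one_le hρ.smooth hρ.nonneg
    (fun x hx => (hρ.eq_zero_iff x).2 hx) fun h => by
      have := (hρ.eq_zero_iff 0).1 h
      norm_num at this

lemma IsModKernel.isBump {n : ℕ} (hn : 1 ≤ n) (hρ : IsModKernel n ρ) : IsBump ρ where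
  smooth := hρ.smooth
  nonneg := hρ.nonneg
  le_one := hρ.le_one
  eq_zero := hρ.eq_zero
  integral_pos := integral_pos_of_eq_zero_of_one_le hρ.smooth hρ.nonneg hρ.eq_zero (by
    have hn' : (1 : ℝ) ≤ n := by exact_mod_cast hn
    rw [hρ.eq_one 0 (by
      rw [norm_zero, sub_nonneg, div_le_one (by linarith)]
      exact hn')]
    exact one_ne_zero)

lemma IsModKernel.le_integral {n : ℕ} (hn : 2 ≤ n) (hρ : IsModKernel n ρ) :
    (1 - 1 / (n : ℝ)) ^ N * (volume (Metric.ball (0 : Eu N) 1)).toReal ≤ ∫ x, ρ x := by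
  have hn' : (2 : ℝ) ≤ n := by exact_mod_cast hn
  have hr : 0 < 1 - 1 / (n : ℝ) := by
    rw [sub_pos, div_lt_one (by linarith)]
    linarith
  have hint : Integrable ρ :=
    hρ.smooth.continuous.integrable_of_hasCompactSupport
      (HasCompactSupport.intro (isCompact_closedBall 0 1) fun x hx => hρ.eq_zero x (by
        simp only [mem_closedBall_zero_iff, not_le] at hx
        exact hx.le))
  calc (1 - 1 / (n : ℝ)) ^ N * (volume (Metric.ball (0 : Eu N) 1)).toReal
      = ∫ x in Metric.ball (0 : Eu N) (1 - 1 / (n : ℝ)), (1 : ℝ) := by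
        rw [setIntegral_const, smul_eq_mul, mul_one, measureReal_def,
          Measure.addHaar_ball_of_pos _ _ hr, finrank_euclideanSpace, Fintype.card_fin,
          ENNReal.toReal_mul, ENNReal.toReal_ofReal (by positivity)]
    _ = ∫ x in Metric.ball (0 : Eu N) (1 - 1 / (n : ℝ)), ρ x :=
        setIntegral_congr_fun measurableSet_ball fun x hx =>
          (hρ.eq_one x (mem_ball_zero_iff.1 hx).le).symm
    _ ≤ ∫ x, ρ x := setIntegral_le_integral hint (ae_of_all _ hρ.nonneg)

end Kernels

/-! ### The two families of operators -/

section Main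

variable {N : ℕ} {Ω : Set (Eu N)} {f : Eu N → ℝ}

lemma MassBound.mono {ρ s : Eu N → ℝ} {A B : ℝ} (h : MassBound Ω ρ s A) (hAB : A ≤ B) :
    MassBound Ω ρ s B := fun y hy => (h y hy).trans (ENNReal.ofReal_le_ofReal hAB)

/-- Averages with radii `η / n` of a `BV` function: the properties shared by both families of
operators. -/
lemma isBV_average_div (hN : 1 ≤ N) (hΩ : IsOpen Ω) (hΩb : Bornology.IsBounded Ω)
    (hf : IsBV Ω f) {ρ η : Eu N → ℝ} (hρ : IsBump ρ) {L κ : ℝ} (hL : 0 ≤ L) (hκ : 0 < κ) {n : ℕ}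
    (hn : 1 ≤ n) (hs : IsRadius Ω (L / n) (fun x => η x / n))
    (hlow : ∀ x ∈ Ω, κ * bdryDist Ω x ^ 2 ≤ η x) (hup : ∀ x ∈ Ω, η x ≤ bdryDist Ω x ^ 2) :
    IsBV Ω (average Ω ρ (fun x => η x / n) f) := by
  have hn' : (1 : ℝ) ≤ n := by exact_mod_cast hn
  obtain ⟨A, hA0, hA⟩ := exists_massBound hΩ hΩb hρ hs (κ := κ / n) (by positivity)
    (fun x hx => bdryDist_pos hN hΩ hΩb hx)
    (fun x hx => by
      rw [div_mul_eq_mul_div]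
      exact div_le_div_of_nonneg_right (hlow x hx) (by positivity))
    (fun x hx => by
      rw [div_le_iff₀ (by positivity)]
      nlinarith [hup x hx, sq_nonneg (bdryDist Ω x)])
  exact isBV_average hΩ hρ hs (by positivity) hA0 hA hf

lemma tendsto_const_div_add (c : ℝ) (m : ℕ) :
    Tendsto (fun k : ℕ => c / ((m + k : ℕ) : ℝ)) atTop (𝓝 0) := by
  have h := (tendsto_const_div_atTop_nhds_zero_nat c).comp (tendsto_add_atTop_nat m)
  refine h.congr fun k => ?_
  simp [add_comm]

lemma div_le_of_le_sq (hD : ∃ D, 0 ≤ D ∧ ∀ x ∈ Ω, bdryDist Ω x ≤ D) :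
    ∃ c : ℝ, ∀ (η : Eu N → ℝ) (n : ℕ), (∀ x ∈ Ω, η x ≤ bdryDist Ω x ^ 2) → ∀ x ∈ Ω,
      η x / n ≤ c / n := by
  obtain ⟨D, _, hD⟩ := hD
  refine ⟨D ^ 2, fun η n h x hx => div_le_div_of_nonneg_right ((h x hx).trans ?_) (by positivity)⟩
  exact pow_le_pow_left₀ Metric.infDist_nonneg (hD x hx) 2

theorem tendstoWeakStarBV_moll (hN : 1 ≤ N) (hΩ : IsOpen Ω) (hΩb : Bornology.IsBounded Ω)
    (hf : IsBV Ω f) {ρ η : Eu N → ℝ} (hρ : IsKernel ρ) (hη : IsStep Ω η) :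
    TendstoWeakStarBV Ω (fun k => moll ρ η (k + 1) f) f := by
  obtain ⟨L₀, hL₀⟩ := hη.grad_bounded
  obtain ⟨κ, hκ, hlow⟩ := hη.lower
  -- For empty `Ω` the given gradient bound may be negative.
  set L := max L₀ 0
  have hL : 0 ≤ L := le_max_right _ _
  have hpos : ∀ x ∈ Ω, 0 < η x := fun x hx => by
    have := bdryDist_pos hN hΩ hΩb hx
    exact lt_of_lt_of_le (by positivity) (hlow x hx)
  have hs : ∀ k : ℕ, IsRadius Ω (L / (1 + k : ℕ)) (fun x => η x / (1 + k : ℕ)) := fun k =>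
    isRadius_div hN hΩ hΩb (by omega) hη.smooth
      (fun x hx => (hL₀ x hx).trans (le_max_left _ _)) hpos (fun x hx => by
        have h1 := hη.lt_dist x hx
        have h2 := bdryDist_pos hN hΩ hΩb hx
        push_cast
        nlinarith [Nat.cast_nonneg (α := ℝ) k])
  have hb := hρ.isBump
  have hT : ∀ k : ℕ, Set.EqOn (average Ω ρ (fun x => η x / (1 + k : ℕ)) f)
      (moll ρ η (k + 1) f) Ω := fun k x hx => by
    rw [average_eq hb (hs k) hx, moll, hb.setIntegral_ball, add_comm k 1]
  have hBV : ∀ k : ℕ, IsBV Ω (average Ω ρ (fun x => η x / (1 + k : ℕ)) f) := fun k =>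
    isBV_average_div hN hΩ hΩb hf hb hL hκ (by omega) (hs k) hlow hη.upper
  -- The 3 bounds $(1+l)/(1-l)$ for $0\le l<\frac12$, where $l$ is the gradient bound of the radius.
  set A := (∫ z, ρ z)⁻¹ * 3 ^ N * (volume (Metric.ball (0 : Eu N) 1)).toReal
  have h0 := hb.integral_pos
  have hA : ∀ᶠ k : ℕ in atTop, L / (1 + k : ℕ) < 1 / 2 ∧
      MassBound Ω ρ (fun x => η x / (1 + k : ℕ)) A := by
    filter_upwards [(tendsto_const_div_add L 1).eventually (gt_mem_nhds one_half_pos)] with k hk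
    have hl0 : 0 ≤ L / (1 + k : ℕ) := by positivity
    refine ⟨hk, (massBound_of_lt_one hΩ hb (hs k) hl0 (by linarith)).mono ?_⟩
    have : (1 + L / (1 + k : ℕ)) / (1 - L / (1 + k : ℕ)) ≤ 3 := by
      rw [div_le_iff₀ (by linarith)]
      linarith
    have h2 : 0 ≤ (1 + L / (1 + k : ℕ)) / (1 - L / (1 + k : ℕ)) :=
      div_nonneg (by linarith) (by linarith)
    exact mul_le_mul_of_nonneg_right (mul_le_mul_of_nonneg_left (pow_le_pow_left₀ h2 this N)
      (by positivity)) (by positivity)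
  obtain ⟨c, hc⟩ := div_le_of_le_sq (exists_bdryDist_bound hΩb)
  have hL1 : TendstoL1 Ω (fun k : ℕ => average Ω ρ (fun x => η x / (1 + k : ℕ)) f) f :=
    tendstoL1_average hΩ hΩb hf.1 (fun _ => hb) hs (hA.mono fun _ h => h.2)
      (tendsto_const_div_add c 1) (fun k => hc η _ hη.upper)
  refine (hL1.congr hΩ.measurableSet hT).tendstoWeakStarBV
    (fun k => (hBV k).congr hΩ.measurableSet (hT k)) hf
    (C := ENNReal.ofReal (A * 2) * totalVariation Ω f)
    (ENNReal.mul_ne_top ENNReal.ofReal_ne_top hf.2.ne) ?_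
  filter_upwards [hA] with k hk
  rw [← totalVariation_congr hΩ.measurableSet (hT k)]
  refine (totalVariation_average_le hΩ hb (hs k) (by positivity) (by positivity) hk.2 hf).trans ?_
  gcongr
  linarith [hk.1]

theorem tendstoStrictBV_modMoll (hN : 1 ≤ N) (hΩ : IsOpen Ω) (hΩb : Bornology.IsBounded Ω)
    (hf : IsBV Ω f) {n₀ : ℕ} {L₀ : ℝ} {ρ η : ℕ → Eu N → ℝ} (hn₀ : 1 ≤ n₀)
    (hσ : ∀ x ∈ Ω, bdryDist Ω x < n₀) (hρ : ∀ n ≥ n₀, IsModKernel n (ρ n))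
    (hη : ∀ n ≥ n₀, IsModStep Ω L₀ n (η n)) :
    TendstoStrictBV Ω (fun k => modMoll Ω ρ η (n₀ + k) f) f := by
  have hn₀' : (1 : ℝ) ≤ n₀ := by exact_mod_cast hn₀
  obtain ⟨m, hm0, hm, hσm⟩ := exists_bdryDist_le hΩb (by linarith) hσ
  set L := max L₀ 0
  have hL : 0 ≤ L := le_max_right _ _
  -- $\sigma\le m<n_0\le n$ gives $1-\sigma/n\ge1-m/n_0>0$, uniformly in $x$ and $n$.
  set κ := (1 - m / n₀) ^ 2
  have hκ : 0 < κ := by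
    have : m / n₀ < 1 := (div_lt_one (by linarith)).2 hm
    exact pow_pos (by linarith) 2
  have hge : ∀ k : ℕ, n₀ + k ≥ n₀ := fun k => Nat.le_add_right _ _
  have hgt : ∀ k : ℕ, (n₀ : ℝ) ≤ (n₀ + k : ℕ) := fun k => by exact_mod_cast hge k
  have hlow : ∀ k, ∀ x ∈ Ω, κ * bdryDist Ω x ^ 2 ≤ η (n₀ + k) x := by
    intro k x hx
    refine le_trans ?_ ((hη _ (hge k)).lower x hx)
    refine mul_le_mul_of_nonneg_right (pow_le_pow_left₀ ?_ ?_ 2) (sq_nonneg _)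
    · have : m / n₀ < 1 := (div_lt_one (by linarith)).2 hm
      linarith
    · have : bdryDist Ω x / (n₀ + k : ℕ) ≤ m / n₀ := by
        have := hgt k
        exact div_le_div₀ hm0 (hσm x hx) (by linarith) this
      linarith
  have hup : ∀ k, ∀ x ∈ Ω, η (n₀ + k) x ≤ bdryDist Ω x ^ 2 := fun k => (hη _ (hge k)).upper
  have hs : ∀ k : ℕ, IsRadius Ω (L / (n₀ + k : ℕ)) (fun x => η (n₀ + k) x / (n₀ + k : ℕ)) :=
    fun k => isRadius_div hN hΩ hΩb (by omega) (hη _ (hge k)).smooth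
      (fun x hx => ((hη _ (hge k)).grad_bounded x hx).trans (le_max_left _ _))
      (fun x hx => by
        have := bdryDist_pos hN hΩ hΩb hx
        exact lt_of_lt_of_le (by positivity) (hlow k x hx))
      (fun x hx => by
        have h1 := bdryDist_pos hN hΩ hΩb hx
        -- $\eta_n\le\sigma^2<n\sigma$ because $\sigma<n_0\le n$; hence the balls of radius
        -- $\eta_n/n$ stay inside `Ω`.
        refine (hup k x hx).trans_lt ?_
        rw [sq]
        exact mul_lt_mul_of_pos_right ((hσ x hx).trans_le (hgt k)) h1)
  have hb : ∀ k, IsBump (ρ (n₀ + k)) := fun k => (hρ _ (hge k)).isBump (by omega)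
  have hT : ∀ k : ℕ, Set.EqOn
      (average Ω (ρ (n₀ + k)) (fun x => η (n₀ + k) x / (n₀ + k : ℕ)) f)
      (modMoll Ω ρ η (n₀ + k) f) Ω := fun k x hx => by
    -- The same substitution in numerator and normalizing integral produces a common factor
    -- $s(x)^N$, which cancels.
    have h1 := integral_scaled_mul (hb k) (hs k) hx f
    have h2 := integral_scaled_mul (hb k) (hs k) hx fun _ => 1
    have hpos := (hs k).pos x hx
    simp only [mul_one] at h2
    rw [average_eq (hb k) (hs k) hx, modMoll, h1, h2, (hb k).setIntegral_ball]
    have := (hb k).integral_pos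
    field_simp
  have hBV : ∀ k : ℕ, IsBV Ω
      (average Ω (ρ (n₀ + k)) (fun x => η (n₀ + k) x / (n₀ + k : ℕ)) f) := fun k =>
    isBV_average_div hN hΩ hΩb hf (hb k) hL hκ (by omega) (hs k) (hlow k) (hup k)
  let l : ℕ → ℝ := fun k => L / (n₀ + k : ℕ)
  -- The first factor bounds $|B_1|/\int\rho_n$, since $\rho_n=1$ on the ball of radius $1-1/n$. For
  -- $n=1$ it is the default inverse of zero, so the mass bound is claimed only for large `k`.
  let a : ℕ → ℝ := fun k => ((1 - 1 / ((n₀ + k : ℕ) : ℝ)) ^ N)⁻¹ * ((1 + l k) / (1 - l k)) ^ N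
  have hl : Tendsto l atTop (𝓝 0) := tendsto_const_div_add L n₀
  have hone : Tendsto (fun k : ℕ => 1 / ((n₀ + k : ℕ) : ℝ)) atTop (𝓝 0) :=
    tendsto_const_div_add 1 n₀
  have ha : Tendsto a atTop (𝓝 1) := by
    have h1 := ((hone.const_sub 1).pow N).inv₀ (by simp)
    have h2 := ((hl.const_add 1).div (hl.const_sub 1) (by simp)).pow N
    simpa [a] using h1.mul h2
  have hA : ∀ᶠ k : ℕ in atTop,
      MassBound Ω (ρ (n₀ + k)) (fun x => η (n₀ + k) x / (n₀ + k : ℕ)) (a k) := by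
    filter_upwards [hl.eventually (gt_mem_nhds one_pos), eventually_ge_atTop 2] with k hk hk2
    have hl0 : 0 ≤ l k := by positivity
    refine (massBound_of_lt_one hΩ (hb k) (hs k) hl0 hk).mono ?_
    have hM := (hρ _ (hge k)).le_integral (by omega)
    have h0 := (hb k).integral_pos
    have hn2 : (2 : ℝ) ≤ (n₀ + k : ℕ) := by exact_mod_cast (by omega : 2 ≤ n₀ + k)
    have hr : 0 < 1 - 1 / ((n₀ + k : ℕ) : ℝ) := by
      rw [sub_pos, div_lt_one (by linarith)]
      linarith
    have hq : 0 ≤ (1 + l k) / (1 - l k) := div_nonneg (by linarith) (by linarith)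
    change (∫ z, ρ (n₀ + k) z)⁻¹ * ((1 + l k) / (1 - l k)) ^ N * _ ≤ _
    rw [mul_right_comm]
    refine mul_le_mul_of_nonneg_right ?_ (by positivity)
    rw [inv_mul_le_iff₀ h0, ← div_eq_mul_inv, le_div_iff₀ (by positivity), mul_comm]
    exact hM
  obtain ⟨c, hc⟩ := div_le_of_le_sq (exists_bdryDist_bound hΩb)
  have hL1 : TendstoL1 Ω
      (fun k : ℕ => average Ω (ρ (n₀ + k)) (fun x => η (n₀ + k) x / (n₀ + k : ℕ)) f) f := by
    refine tendstoL1_average hΩ hΩb hf.1 hb hs (A := 2) ?_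
      (tendsto_const_div_add c n₀) (fun k => hc _ _ (hup k))
    filter_upwards [hA, ha.eventually (gt_mem_nhds one_lt_two)] with k h1 h2
    exact h1.mono h2.le
  refine (hL1.congr hΩ.measurableSet hT).tendstoStrictBV
    (fun k => (hBV k).congr hΩ.measurableSet (hT k)) hf (c := fun k => a k * (1 + l k)) ?_ ?_
  · simpa using ha.mul (hl.const_add 1)
  · filter_upwards [hA, ha.eventually (lt_mem_nhds zero_lt_one)] with k hk hk0
    rw [← totalVariation_congr hΩ.measurableSet (hT k)]
    exact totalVariation_average_le hΩ (hb k) (hs k) (by positivity) hk0.le hk hf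

end Main

end

end BVMollifier

theorem proposition5p9 {N : ℕ} (hN : 1 ≤ N) (Ω : Set (BVMollifier.Eu N))
    (hΩ : IsOpen Ω) (hΩb : Bornology.IsBounded Ω)
    (f : BVMollifier.Eu N → ℝ) (hf : BVMollifier.IsBV Ω f) :
    (BVMollifier.HasLipschitzBoundary Ω →
      ∀ ρ η : BVMollifier.Eu N → ℝ, BVMollifier.IsKernel ρ → BVMollifier.IsStep Ω η →
        BVMollifier.TendstoWeakStarBV Ω (fun k => BVMollifier.moll ρ η (k + 1) f) f) ∧
    (∀ (n₀ : ℕ) (L : ℝ) (ρ η : ℕ → BVMollifier.Eu N → ℝ), 1 ≤ n₀ →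
      (∀ x ∈ Ω, BVMollifier.bdryDist Ω x < n₀) →
      (∀ n ≥ n₀, BVMollifier.IsModKernel n (ρ n)) →
      (∀ n ≥ n₀, BVMollifier.IsModStep Ω L n (η n)) →
        BVMollifier.TendstoStrictBV Ω (fun k => BVMollifier.modMoll Ω ρ η (n₀ + k) f) f) := by
  refine ⟨fun _ ρ η hρ hη => BVMollifier.tendstoWeakStarBV_moll hN hΩ hΩb hf hρ hη, ?_⟩
  exact fun n₀ L ρ η hn₀ hσ hρ hη => BVMollifier.tendstoStrictBV_modMoll hN hΩ hΩb hf hn₀ hσ hρ hη
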